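/- Let $p,q\ge 0$ and let $V(\mathbb R)=\mathbb R^{p+q}$ carry the form $Q(v,w)=\sum_{\alpha\le p}v_\alpha w_\alpha-\sum_{\mu>p}v_\mu w_\mu$, with standard basis $e_1,\dots,e_{p+q}$ (indices $\alpha\le p<\mu$). Let $G(\mathbb R)^+$ be the identity component of the orthogonal group of $Q$, $\mathfrak g$ its Lie algebra, $z_0=\langle e_{p+1},\dots,e_{p+q}\rangle$ with inner product $\langle w,w'\rangle=-Q(w,w')$, $\mathrm{pr}\colon V(\mathbb R)\to z_0$ the orthogonal projection, $K$ the stabilizer of $z_0$ in $G(\mathbb R)^+$, with Lie algebra $\mathfrak k$, and $\mathfrak p$ the orthogonal complement of $\mathfrak k$ in $\mathfrak g$. Let $\mathbb D^+=G(\mathbb R)^+/K$ (the space of negative $q$-planes, $gK\leftrightarrow gz_0$) and $E=G(\mathbb R)^+\times_K z_0$, i.e. $[gk,w]=[g,kw]$ for $k\in K$. Forms on $\mathbb D^+$ and on $E$ are identified with basic (horizontal and $K$-invariant) forms on $G(\mathbb R)^+$ and on $G(\mathbb R)^+\times z_0$. For $v\in V(\mathbb R)$ let $s_v\colon\mathbb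 D^+\to E$, $s_v(gz_0)=[g,\mathrm{pr}(g^{-1}v)]$. *Kudla–Millson form.* Let $\omega_{\alpha\mu}\in\mathfrak p^*$ be dual to $X_{\alpha\mu}\in\mathfrak p$, where $X_{\alpha\mu}$ exchanges $e_\alpha$ and $e_\mu$ and kills the other basis vectors. At the base point, $$\varphi_{KM}(v)_e=\frac1{2^q}\prod_{\mu=p+1}^{p+q}\ \sum_{\alpha=1}^p\omega_{\alpha\mu}\otimes\Bigl(x_\alpha-\frac1{2\pi}\frac{\partial}{\partial x_\alpha}\Bigr)\ e^{-\pi\sum_i x_i^2}\Big|_{x=v}\in\textstyle\bigwedge^q\mathfrak p^*,$$ the factors being taken in increasing order of $\mu$, and $\varphi_{KM}(v)$ is its extension to $\mathbb D^+$ with $L_g^*\varphi_{KM}(v)=\varphi_{KM}(g^{-1}v)$ for $g\in G(\mathbb R)^+$. *Mathai–Quillen form.* Let $\theta$ be the $\mathfrak k$-component of the Maurer–Cartan form of $G(\mathbb R)^+$, $\widetilde\theta$ its pullback to $G(\mathbb R)^+\times z_0$, $\widetilde R=d\widetilde\theta+\frac12[\widetilde\theta,\widetilde\theta]$ its curvature,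 $\rho$ the restriction of endomorphisms in $\mathfrak k$ to $z_0$, $\mathbf s(g,w)=w$ the tautological section and $\widetilde\nabla\mathbf s=d\mathbf s+\rho(\widetilde\theta)\mathbf s$. View $\rho(\widetilde R)$ as a form with values in $\bigwedge^2z_0$ by $A\mapsto\sum_{\mu<\nu}\langle Ae_\mu,e_\nu\rangle e_\mu\wedge e_\nu$, and multiply forms with values in $\bigwedge z_0$ by $(\omega\otimes s)\wedge(\eta\otimes t)=(-1)^{\deg s\deg\eta}(\omega\wedge\eta)\otimes(s\wedge t)$. Orient $z_0$ by an orthonormal basis $b_1,\dots,b_q$, let $\int^B(\omega\otimes s)=\langle s,b_1\wedge\dots\wedge b_q\rangle\,\omega$, and $$U_{MQ}=(-1)^{\frac{q(q+1)}2}(2\pi)^{-\frac q2}\int^B\exp\bigl(-2\pi\lVert\mathbf s\rVert^2-2\sqrt\pi\,\widetilde\nabla\mathbf s+\rho(\widetilde R)\bigr).$$ Let $\varepsilon=\pm1$ be the determinant of $(b_1,\dots,b_q)$ with respect to $(e_{p+1},\dots,e_{p+q})$. **Theorem.** Let $\Gamma\subset G(\mathbb R)^+$ be a subgroup, $v\in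 V(\mathbb R)$ and $\Gamma_v$ the stabilizer of $v$ in $\Gamma$. Then $U_{MQ}$ is a smooth $\Gamma_v$-invariant $q$-form on $E$, both $s_v^*U_{MQ}$ and $\varphi_{KM}(v)$ are smooth $\Gamma_v$-invariant $q$-forms on $\mathbb D^+$ (that is, $q$-forms on $\Gamma_v\backslash\mathbb D^+$), and $$\varphi_{KM}(v)=(-1)^q\varepsilon\;2^{-\frac q2}e^{-\pi Q(v,v)}\,s_v^*U_{MQ}.$$ In particular, if $z_0$ is oriented by $(-e_{p+1},\dots,-e_{p+q})$, then $\varphi_{KM}(v)=2^{-\frac q2}e^{-\pi Q(v,v)}\,s_v^*U_{MQ}$. -/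

import Mathlib

open scoped TensorProduct SchwartzMap

namespace KudlaMillson

noncomputable section

/-! ## The quadratic space, the group and its Lie algebra -/

/-- `V(ℝ)` in the coordinates of the orthogonal basis `e₁, …, e_{p+q}`:
`Sum.inl α` indexes the positive basis vectors, `Sum.inr μ` the negative ones. -/
abbrev V (p q : ℕ) : Type := Fin p ⊕ Fin q → ℝ

/-- The negative plane `z₀` spanned by the last `q` basis vectors, in coordinates. -/
abbrev Z (q : ℕ) : Type := Fin q → ℝ

/-- The symmetric bilinear form `Q` of signature `(p, q)`. -/
def form {p q : ℕ} (v w : V p q) : ℝ :=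
  ∑ α, v (Sum.inl α) * w (Sum.inl α) - ∑ μ, v (Sum.inr μ) * w (Sum.inr μ)

/-- The inclusion of `z₀` in `V(ℝ)`. -/
def incl (p q : ℕ) : Z q →ₗ[ℝ] V p q where
  toFun w := Sum.elim 0 w
  map_add' w w' := by ext (i | i) <;> simp
  map_smul' c w := by ext (i | i) <;> simp

/-- The orthogonal projection of `V(ℝ)` onto `z₀`. -/
def pr (p q : ℕ) : V p q →ₗ[ℝ] Z q where
  toFun v := fun μ => v (Sum.inr μ)
  map_add' _ _ := rfl
  map_smul' _ _ := rfl

/-- The plane `z₀` as a subspace of `V(ℝ)`. -/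
def z₀ (p q : ℕ) : Submodule ℝ (V p q) := LinearMap.range (incl p q)

/-- The Euclidean inner product `⟨w, w'⟩ = -Q(w, w')` on `z₀`. -/
def fiberInner (p : ℕ) {q : ℕ} (w w' : Z q) : ℝ := -form (incl p q w) (incl p q w')

/-- The orthogonal group `G(ℝ)` of `Q`. -/
def orthogonalGroup (p q : ℕ) : Subgroup (GL (Fin p ⊕ Fin q) ℝ) where
  carrier := {g | ∀ v w : V p q, form (g.1.mulVec v) (g.1.mulVec w) = form v w}
  mul_mem' {a b} ha hb v w := by
    have h := ha (b.1.mulVec v) (b.1.mulVec w)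
    rw [hb] at h
    simpa [Matrix.mulVec_mulVec] using h
  one_mem' v w := by simp
  inv_mem' {a} ha v w := by
    have h := ha ((a⁻¹).1.mulVec v) ((a⁻¹).1.mulVec w)
    have e : a.1 * (a⁻¹).1 = 1 := a.mul_inv
    rw [Matrix.mulVec_mulVec, Matrix.mulVec_mulVec, e, Matrix.one_mulVec, Matrix.one_mulVec] at h
    exact h.symm

/-- `G(ℝ)⁺`, the connected component of the identity. -/
def Gplus (p q : ℕ) : Subgroup (orthogonalGroup p q) :=
  Subgroup.connectedComponentOfOne (orthogonalGroup p q)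

/-- The matrix of an element of `G(ℝ)⁺`. -/
def mat {p q : ℕ} (g : Gplus p q) : Matrix (Fin p ⊕ Fin q) (Fin p ⊕ Fin q) ℝ := g.1.1.1

/-- The action of `G(ℝ)⁺` on `V(ℝ)`. -/
def act {p q : ℕ} (g : Gplus p q) : V p q →ₗ[ℝ] V p q := (mat g).mulVecLin

lemma mat_mul {p q : ℕ} (g h : Gplus p q) : mat (g * h) = mat g * mat h := rfl

lemma mat_one {p q : ℕ} : mat (1 : Gplus p q) = 1 := rfl

lemma act_mul {p q : ℕ} (g h : Gplus p q) (v : V p q) : act (g * h) v = act g (act h v) := by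
  simp [act, mat_mul, Matrix.mulVec_mulVec]

lemma act_one {p q : ℕ} (v : V p q) : act (1 : Gplus p q) v = v := by
  simp [act, mat_one]

lemma act_inv_act {p q : ℕ} (g : Gplus p q) (v : V p q) : act g⁻¹ (act g v) = v := by
  rw [← act_mul, inv_mul_cancel, act_one]

lemma act_act_inv {p q : ℕ} (g : Gplus p q) (v : V p q) : act g (act g⁻¹ v) = v := by
  rw [← act_mul, mul_inv_cancel, act_one]

lemma form_act {p q : ℕ} (g : Gplus p q) (v w : V p q) :
    form (act g v) (act g w) = form v w := g.1.2 v w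

/-- `K`, the stabilizer of `z₀` in `G(ℝ)⁺`. (By connectedness it preserves the orientation of
`z₀` too.) -/
def K (p q : ℕ) : Subgroup (Gplus p q) where
  carrier := {k | (z₀ p q).map (act k) = z₀ p q}
  mul_mem' {a b} ha hb := by
    have e : act (a * b) = act a ∘ₗ act b := LinearMap.ext fun v => act_mul a b v
    change (z₀ p q).map (act (a * b)) = z₀ p q
    rw [e, Submodule.map_comp, show (z₀ p q).map (act b) = z₀ p q from hb]
    exact ha
  one_mem' := by
    have e : act (1 : Gplus p q) = LinearMap.id := LinearMap.ext fun v => act_one v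
    change (z₀ p q).map (act (1 : Gplus p q)) = z₀ p q
    rw [e, Submodule.map_id]
  inv_mem' {a} ha := by
    have e : act a⁻¹ ∘ₗ act a = LinearMap.id := LinearMap.ext fun v => act_inv_act a v
    change (z₀ p q).map (act a⁻¹) = z₀ p q
    conv_lhs => rw [← show (z₀ p q).map (act a) = z₀ p q from ha]
    rw [← Submodule.map_comp, e, Submodule.map_id]

lemma form_add_left {p q : ℕ} (u v w : V p q) : form (u + v) w = form u w + form v w := by
  simp only [form, Pi.add_apply, add_mul, Finset.sum_add_distrib]; ring

lemma form_smul_left {p q : ℕ} (c : ℝ) (v w : V p q) : form (c • v) w = c * form v w := by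
  simp only [form, Pi.smul_apply, smul_eq_mul, mul_sub, Finset.mul_sum, mul_assoc]

lemma form_comm {p q : ℕ} (v w : V p q) : form v w = form w v := by
  simp only [form, mul_comm]

lemma form_add_right {p q : ℕ} (u v w : V p q) : form u (v + w) = form u v + form u w := by
  rw [form_comm, form_add_left, form_comm v, form_comm w]

lemma form_smul_right {p q : ℕ} (c : ℝ) (v w : V p q) : form v (c • w) = c * form v w := by
  rw [form_comm, form_smul_left, form_comm w]

/-- The Lie algebra `𝔤` of `G(ℝ)⁺`: the matrices that are skew for `Q`, that is, the block
matrices `(A x; ᵗx B)` with `A` and `B` skew-symmetric. -/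
def LieG (p q : ℕ) : Submodule ℝ (Matrix (Fin p ⊕ Fin q) (Fin p ⊕ Fin q) ℝ) where
  carrier := {A | ∀ v w : V p q, form (A.mulVec v) w = -form v (A.mulVec w)}
  add_mem' {A B} hA hB v w := by
    rw [Matrix.add_mulVec, Matrix.add_mulVec, form_add_left, form_add_right, hA, hB]; ring
  zero_mem' v w := by simp [form]
  smul_mem' c A hA v w := by
    rw [Matrix.smul_mulVec, Matrix.smul_mulVec, form_smul_left, form_smul_right, hA]; ring

/-- The Gram matrix of `Q`. -/
def gram (p q : ℕ) : Matrix (Fin p ⊕ Fin q) (Fin p ⊕ Fin q) ℝ :=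
  Matrix.diagonal (Sum.elim (fun _ => 1) (fun _ => -1))

lemma form_eq_dotProduct {p q : ℕ} (v w : V p q) : form v w = v ⬝ᵥ (gram p q).mulVec w := by
  simp [form, gram, dotProduct, Matrix.mulVec_diagonal, Fintype.sum_sum_type, sub_eq_add_neg]

lemma gram_mul_gram (p q : ℕ) : gram p q * gram p q = 1 := by
  rw [gram, Matrix.diagonal_mul_diagonal, ← Matrix.diagonal_one]
  congr 1
  ext (i | i) <;> simp

lemma mem_LieG_iff {p q : ℕ} (A : Matrix (Fin p ⊕ Fin q) (Fin p ⊕ Fin q) ℝ) :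
    A ∈ LieG p q ↔ A.transpose * gram p q = -(gram p q * A) := by
  have h1 : ∀ v w : V p q, form (A.mulVec v) w = v ⬝ᵥ (A.transpose * gram p q).mulVec w := by
    intro v w
    rw [form_eq_dotProduct, ← Matrix.mulVec_mulVec, Matrix.dotProduct_mulVec v,
      Matrix.vecMul_transpose]
  have h2 : ∀ v w : V p q, -form v (A.mulVec w) = v ⬝ᵥ (-(gram p q * A)).mulVec w := by
    intro v w
    rw [form_eq_dotProduct, Matrix.mulVec_mulVec, Matrix.neg_mulVec, dotProduct_neg]
  change (∀ v w : V p q, form (A.mulVec v) w = -form v (A.mulVec w)) ↔ _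
  constructor
  · intro h
    ext i j
    have := h (Pi.single i 1) (Pi.single j 1)
    rw [h1, h2] at this
    simpa using this
  · intro h v w
    rw [h1, h2, h]

/-- The Lie bracket of `𝔤`, the commutator of matrices. -/
def bracket {p q : ℕ} (A B : LieG p q) : LieG p q :=
  ⟨A.1 * B.1 - B.1 * A.1, fun v w => by
    have hA := A.2
    have hB := B.2
    change ∀ v w : V p q, form (A.1.mulVec v) w = -form v (A.1.mulVec w) at hA
    change ∀ v w : V p q, form (B.1.mulVec v) w = -form v (B.1.mulVec w) at hB
    rw [sub_eq_add_neg, ← neg_one_smul ℝ (B.1 * A.1), Matrix.add_mulVec, Matrix.add_mulVec,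
      Matrix.smul_mulVec, Matrix.smul_mulVec, form_add_left, form_add_right, form_smul_left,
      form_smul_right, ← Matrix.mulVec_mulVec, ← Matrix.mulVec_mulVec, ← Matrix.mulVec_mulVec,
      ← Matrix.mulVec_mulVec, hA, hB, hB, hA]
    ring⟩

/-- The projection of `𝔤 = 𝔨 ⊕ 𝔭` onto `𝔨`: it keeps the diagonal blocks. -/
def projK (p q : ℕ) : LieG p q →ₗ[ℝ] LieG p q where
  toFun A := ⟨Matrix.fromBlocks A.1.toBlocks₁₁ 0 0 A.1.toBlocks₂₂, by
    have h := (mem_LieG_iff A.1).1 A.2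
    rw [mem_LieG_iff]
    ext (i | i) (j | j)
    · simpa [gram, Matrix.toBlocks₁₁] using congrFun (congrFun h (Sum.inl i)) (Sum.inl j)
    · simp [gram]
    · simp [gram]
    · simpa [gram, Matrix.toBlocks₂₂] using congrFun (congrFun h (Sum.inr i)) (Sum.inr j)⟩
  map_add' A B := by
    ext (i | i) (j | j) <;> simp [Matrix.toBlocks₁₁, Matrix.toBlocks₂₂]
  map_smul' c A := by
    ext (i | i) (j | j) <;> simp [Matrix.toBlocks₁₁, Matrix.toBlocks₂₂]

/-- The Lie algebra `𝔨` of `K`, as a subspace of `𝔤`. -/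
def LieK (p q : ℕ) : Submodule ℝ (LieG p q) := LinearMap.range (projK p q)

/-- The adjoint action `Ad(g) A = g A g⁻¹` on `𝔤`. -/
def Ad {p q : ℕ} (g : Gplus p q) : LieG p q →ₗ[ℝ] LieG p q where
  toFun A := ⟨mat g * A.1 * mat g⁻¹, fun v w => by
    have h1 := form_act g (A.1.mulVec ((mat g⁻¹).mulVec v)) (act g⁻¹ w)
    have h2 := form_act g (act g⁻¹ v) (A.1.mulVec ((mat g⁻¹).mulVec w))
    rw [act_act_inv] at h1 h2
    have h3 := A.2 (act g⁻¹ v) (act g⁻¹ w)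
    simp only [act, Matrix.mulVecLin_apply] at h1 h2 h3
    rw [← Matrix.mulVec_mulVec, ← Matrix.mulVec_mulVec, ← Matrix.mulVec_mulVec,
      ← Matrix.mulVec_mulVec, h1, h2, h3]⟩
  map_add' A B := by
    ext i j; simp [mul_add, add_mul]
  map_smul' c A := by
    ext i j; simp

/-- The representation of `𝔤`-matrices on `z₀`: `X ↦ X|_{z₀}`, which for `X ∈ 𝔨` is the derivative
of the representation of `K` on `z₀`. -/
def rhoLie (p q : ℕ) : LieG p q →ₗ[ℝ] Z q →ₗ[ℝ] Z q :=
  LinearMap.mk₂ ℝ (fun X w => pr p q (X.1.mulVec (incl p q w)))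
    (fun X Y w => by simp [Matrix.add_mulVec])
    (fun c X w => by simp [Matrix.smul_mulVec])
    (fun X w w' => by simp [Matrix.mulVec_add])
    (fun c X w => by simp [Matrix.mulVec_smul])

/-- The action of `g` on `z₀`; for `g ∈ K` this is the representation `ρ(g) = g|_{z₀}`. -/
def rho {p q : ℕ} (g : Gplus p q) : Z q →ₗ[ℝ] Z q := pr p q ∘ₗ act g ∘ₗ incl p q

lemma form_exp {p q : ℕ} (A : LieG p q) (v w : V p q) :
    form ((NormedSpace.exp A.1).mulVec v) ((NormedSpace.exp A.1).mulVec w) = form v w := by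
  have hA := (mem_LieG_iff A.1).1 A.2
  have hinv : (gram p q)⁻¹ = gram p q := Matrix.inv_eq_right_inv (gram_mul_gram p q)
  have hu : IsUnit (gram p q) := IsUnit.of_mul_eq_one _ (gram_mul_gram p q)
  have h1 : A.1.transpose = gram p q * (-A.1) * (gram p q)⁻¹ := by
    rw [hinv, mul_neg, ← hA, mul_assoc, gram_mul_gram, mul_one]
  have h2 : (NormedSpace.exp A.1).transpose
      = gram p q * NormedSpace.exp (-A.1) * gram p q := by
    rw [← Matrix.exp_transpose, h1, Matrix.exp_conj _ _ hu, hinv]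
  have h3 : NormedSpace.exp (-A.1) * NormedSpace.exp A.1 = 1 := by
    rw [← Matrix.exp_add_of_commute _ _ (Commute.neg_left (Commute.refl A.1)), neg_add_cancel,
      NormedSpace.exp_zero]
  have h4 : (NormedSpace.exp A.1).transpose * (gram p q * NormedSpace.exp A.1) = gram p q := by
    rw [h2, mul_assoc, ← mul_assoc (gram p q) (gram p q), gram_mul_gram, one_mul, mul_assoc, h3,
      mul_one]
  conv_rhs => rw [form_eq_dotProduct, ← h4, ← Matrix.mulVec_mulVec, ← Matrix.mulVec_mulVec,
    Matrix.dotProduct_mulVec v, Matrix.vecMul_transpose]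
  rw [form_eq_dotProduct]

/-- `exp A` as an element of the orthogonal group. -/
def expO {p q : ℕ} (A : LieG p q) : orthogonalGroup p q :=
  ⟨⟨NormedSpace.exp A.1, NormedSpace.exp (-A.1),
    by rw [← Matrix.exp_add_of_commute _ _ (Commute.neg_right (Commute.refl A.1)), add_neg_cancel,
      NormedSpace.exp_zero],
    by rw [← Matrix.exp_add_of_commute _ _ (Commute.neg_left (Commute.refl A.1)), neg_add_cancel,
      NormedSpace.exp_zero]⟩, form_exp A⟩

lemma expO_mem_Gplus {p q : ℕ} (A : LieG p q) : expO A ∈ Gplus p q := by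
  have hexp : Continuous (NormedSpace.exp :
      Matrix (Fin p ⊕ Fin q) (Fin p ⊕ Fin q) ℝ → Matrix (Fin p ⊕ Fin q) (Fin p ⊕ Fin q) ℝ) :=
    open scoped Matrix.Norms.Operator in NormedSpace.exp_continuous
  have hc : Continuous fun t : ℝ => expO (t • A) := by
    refine Continuous.subtype_mk (Units.continuous_iff.2 ⟨?_, ?_⟩) _
    · exact hexp.comp (continuous_id.smul continuous_const)
    · exact hexp.comp (continuous_id.smul continuous_const).neg
  have h0 : expO ((0 : ℝ) • A) = 1 := by
    apply Subtype.ext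
    apply Units.ext
    simp [expO]
  have h1 : expO ((1 : ℝ) • A) = expO A := by rw [one_smul]
  have hr := (isPreconnected_range hc).subset_connectedComponent (x := 1) ⟨0, h0⟩
  exact hr ⟨1, h1⟩

/-- The exponential map `𝔤 → G(ℝ)⁺`. -/
def expG {p q : ℕ} (A : LieG p q) : Gplus p q := ⟨expO A, expO_mem_Gplus A⟩

/-! ## The symmetric space, the bundle and the section `s_v` -/

/-- `𝔻⁺`, identified with `G(ℝ)⁺ / K` by `g K ↦ g z₀`. -/
abbrev DPlus (p q : ℕ) : Type := Gplus p q ⧸ K p q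

/-- The relation on `G(ℝ)⁺ × z₀` that identifies `(g, w)` with `(g k, k⁻¹ w)` for `k ∈ K`. -/
def bundleSetoid (p q : ℕ) : Setoid (Gplus p q × Z q) where
  r x y := ∃ k ∈ K p q, y.1 = x.1 * k ∧ act k (incl p q y.2) = incl p q x.2
  iseqv :=
    { refl := fun x => ⟨1, one_mem _, by simp, act_one _⟩
      symm := by
        rintro x y ⟨k, hk, h1, h2⟩
        exact ⟨k⁻¹, inv_mem hk, by simp [h1], by rw [← h2, act_inv_act]⟩
      trans := by
        rintro x y z ⟨k, hk, h1, h2⟩ ⟨l, hl, h3, h4⟩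
        exact ⟨k * l, mul_mem hk hl, by rw [h3, h1, mul_assoc], by rw [act_mul, h4, h2]⟩ }

/-- The total space of the bundle `E = G(ℝ)⁺ ×_K z₀` over `𝔻⁺`. -/
def E (p q : ℕ) : Type := Quotient (bundleSetoid p q)

/-- The class `[g, w]`. -/
def E.mk {p q : ℕ} (g : Gplus p q) (w : Z q) : E p q := Quotient.mk (bundleSetoid p q) (g, w)

lemma form_incl {p q : ℕ} (v : V p q) (w : Z q) :
    form v (incl p q w) = form (incl p q (pr p q v)) (incl p q w) := by
  simp [form, incl, pr]

/-- Elements of `K` commute with the orthogonal projection onto `z₀`. -/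
lemma act_incl_pr {p q : ℕ} (k : Gplus p q) (hk : k ∈ K p q) (u : V p q) :
    act k (incl p q (pr p q u)) = incl p q (pr p q (act k u)) := by
  have hmap : (z₀ p q).map (act k) = z₀ p q := hk
  have hmem : act k (incl p q (pr p q u)) ∈ z₀ p q := by
    rw [← hmap]; exact Submodule.mem_map_of_mem ⟨_, rfl⟩
  obtain ⟨w, hw⟩ := hmem
  have key : ∀ w' : Z q, form (incl p q w) (incl p q w')
      = form (incl p q (pr p q (act k u))) (incl p q w') := by
    intro w'
    have h' : incl p q w' ∈ (z₀ p q).map (act k) := by rw [hmap]; exact ⟨_, rfl⟩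
    obtain ⟨_, ⟨y, rfl⟩, hy⟩ := h'
    rw [hw, ← form_incl, ← hy, form_act, form_act, form_incl u]
  rw [← hw]
  congr 1
  ext μ
  have := key (Pi.single μ 1)
  simpa [form, incl, Pi.single_apply] using this

/-- The section `s_v : z ↦ [g_z, pr(g_z⁻¹ v)]` of `E`, where `z = g_z z₀`. -/
def sectionV {p q : ℕ} (v : V p q) : DPlus p q → E p q :=
  Quotient.lift (fun g : Gplus p q => E.mk g (pr p q (act g⁻¹ v))) (by
    intro g g' h
    have hk : g⁻¹ * g' ∈ K p q := QuotientGroup.leftRel_apply.1 h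
    refine Quotient.sound ⟨g⁻¹ * g', hk, by simp, ?_⟩
    change act (g⁻¹ * g') (incl p q (pr p q (act g'⁻¹ v))) = incl p q (pr p q (act g⁻¹ v))
    rw [act_incl_pr _ hk, act_mul, act_act_inv])

/-- The function `f_s : G(ℝ)⁺ → z₀` attached to a section `s` of `E`: `s(g z₀) = [g, f_s(g)]`. -/
def sectionMap {p q : ℕ} (s : DPlus p q → E p q) (g : Gplus p q) : Z q :=
  Function.invFun (fun w : Z q => E.mk g w) (s (QuotientGroup.mk g))

/-! ## Differential forms

Tangent vectors of `G(ℝ)⁺` at `g` are identified with `𝔤` by left translation: `A ∈ 𝔤` stands for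
the velocity of `t ↦ g exp(tA)`. Likewise `(A, u) ∈ 𝔤 × z₀` stands for the velocity of
`t ↦ (g exp(tA), w + tu)` at the point `(g, w)` of `G(ℝ)⁺ × z₀`. A differential form on one of
these manifolds is thus a function to the exterior algebra of `𝔤*`, resp. of `(𝔤 × z₀)*`.
Differential forms on the quotients `𝔻⁺ = G(ℝ)⁺ / K` and `E = (G(ℝ)⁺ × z₀) / K` are the basic forms:
those that are horizontal and `K`-invariant. -/

/-- The exterior algebra `⋀ T*` of the dual of `T`. -/
abbrev Forms (T : Type) [AddCommGroup T] [Module ℝ T] : Type :=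
  ExteriorAlgebra ℝ (Module.Dual ℝ T)

/-- The curve `t ↦ g exp(tA)`. -/
def curveG {p q : ℕ} (g : Gplus p q) (A : LieG p q) (t : ℝ) : Gplus p q := g * expG (t • A)

/-- The curve `t ↦ (g exp(tA), w + tu)`. -/
def curveE {p q : ℕ} (x : Gplus p q × Z q) (ξ : LieG p q × Z q) (t : ℝ) : Gplus p q × Z q :=
  (curveG x.1 ξ.1 t, x.2 + t • ξ.2)

open Classical in
/-- The differential at `x` of a `z₀`-valued function: the linear map that sends a tangent vector
`ξ` to the derivative of the function along the curve of direction `ξ` (and `0` if there is no such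
linear map). -/
def differential {P T : Type} [AddCommGroup T] [Module ℝ T] {q : ℕ} (curve : P → T → ℝ → P)
    (f : P → Z q) (x : P) : T →ₗ[ℝ] Z q :=
  if h : ∃ L : T →ₗ[ℝ] Z q, ∀ ξ : T, HasDerivAt (fun t : ℝ => f (curve x ξ t)) (L ξ) 0 then
    h.choose
  else 0

/-- The pullback of (the value at a point of) a form by a linear map of tangent spaces. -/
def pullbackLin {T T' : Type} [AddCommGroup T] [Module ℝ T] [AddCommGroup T'] [Module ℝ T']
    (L : T →ₗ[ℝ] T') : Forms T' →ₐ[ℝ] Forms T :=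
  ExteriorAlgebra.map L.dualMap

/-- The interior product `ι_ξ`. -/
def interior {T : Type} [AddCommGroup T] [Module ℝ T] (ξ : T) : Forms T →ₗ[ℝ] Forms T :=
  CliffordAlgebra.contractLeft (Module.Dual.eval ℝ T ξ)

/-- The pullback `s^* α` to `𝔻⁺` of a form `α` on `E` by a section `s` of `E`: on the level of
`G(ℝ)⁺` it is the pullback by `g ↦ (g, f_s(g))`, which covers `s`. -/
def pullbackSection {p q : ℕ} (s : DPlus p q → E p q)
    (α : Gplus p q × Z q → Forms (LieG p q × Z q)) (g : Gplus p q) : Forms (LieG p q) :=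
  pullbackLin (LinearMap.prod LinearMap.id (differential curveG (sectionMap s) g))
    (α (g, sectionMap s g))

/-- A function on a subset `P` of a normed space `W`, with values in a finite-dimensional space, is
smooth if each of its coordinates is the restriction of a smooth function. It is used for the closed
submanifold of the space of matrices `G(ℝ)⁺`, and for `G(ℝ)⁺ × z₀`. -/
def IsSmooth {P W A : Type} [NormedAddCommGroup W] [NormedSpace ℝ W] [AddCommGroup A] [Module ℝ A]
    (emb : P → W) (α : P → A) : Prop :=
  ∀ ℓ : Module.Dual ℝ A, ∃ F : W → ℝ, ContDiff ℝ ((⊤ : ℕ∞) : WithTop ℕ∞) F ∧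
    ∀ x, F (emb x) = ℓ (α x)

/-- The matrix entries, as a point of a normed space. -/
def entries {p q : ℕ} (g : Gplus p q) : Fin p ⊕ Fin q → Fin p ⊕ Fin q → ℝ := fun i j => mat g i j

/-- `α` is a smooth `n`-form on `Δ \ 𝔻⁺`, that is, a smooth basic `n`-form on `G(ℝ)⁺` invariant
under left translation by `Δ`. -/
structure IsFormOnD {p q : ℕ} (Δ : Subgroup (Gplus p q)) (n : ℕ)
    (α : Gplus p q → Forms (LieG p q)) : Prop where
  degree : ∀ g, α g ∈ ⋀[ℝ]^n (Module.Dual ℝ (LieG p q))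
  smooth : IsSmooth (entries (p := p) (q := q)) α
  /-- `X ∈ 𝔨` stands for the vertical vector `d/dt (g exp(tX))`. -/
  horizontal : ∀ g, ∀ X ∈ LieK p q, interior X (α g) = 0
  /-- `R_k^* α = α`; left translations turn the differential of `R_k` into `Ad(k⁻¹)`. -/
  invariant : ∀ g, ∀ k ∈ K p q, pullbackLin (Ad k⁻¹) (α (g * k)) = α g
  leftInvariant : ∀ δ ∈ Δ, ∀ g, α (δ * g) = α g

/-- `α` is a smooth `n`-form on `Δ \ E`, that is, a smooth basic `n`-form on `G(ℝ)⁺ × z₀` invariant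
under left translation by `Δ`. -/
structure IsFormOnE {p q : ℕ} (Δ : Subgroup (Gplus p q)) (n : ℕ)
    (α : Gplus p q × Z q → Forms (LieG p q × Z q)) : Prop where
  degree : ∀ x, α x ∈ ⋀[ℝ]^n (Module.Dual ℝ (LieG p q × Z q))
  smooth : IsSmooth (fun x : Gplus p q × Z q => (entries x.1, x.2)) α
  /-- `(X, -X w)` is the vertical vector `d/dt (g exp(tX), exp(-tX) w)`. -/
  horizontal : ∀ g w, ∀ X ∈ LieK p q, interior (X, -rhoLie p q X w) (α (g, w)) = 0
  /-- `R_k^* α = α` for `R_k (g, w) = (g k, k⁻¹ w)`. -/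
  invariant : ∀ g w, ∀ k ∈ K p q,
    pullbackLin (LinearMap.prodMap (Ad k⁻¹) (rho k⁻¹)) (α (g * k, rho k⁻¹ w)) = α (g, w)
  leftInvariant : ∀ δ ∈ Δ, ∀ g w, α (δ * g, w) = α (g, w)

/-! ## The Mathai–Quillen form -/

/-- The connection form `θ̃` on `G(ℝ)⁺ × z₀`, the pullback of the projection to `𝔨` of the
Maurer–Cartan form (which is the identity of `𝔤` in the left trivialization). -/
def connection (p q : ℕ) : LieG p q × Z q →ₗ[ℝ] LieG p q :=
  projK p q ∘ₗ LinearMap.fst ℝ (LieG p q) (Z q)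

/-- The covariant derivative `df + ρ(θ̃) f` at `x` of `f : G(ℝ)⁺ × z₀ → z₀`. -/
def covariantDerivative {p q : ℕ} (f : Gplus p q × Z q → Z q) (x : Gplus p q × Z q) :
    LieG p q × Z q →ₗ[ℝ] Z q :=
  differential curveE f x + (rhoLie p q).flip (f x) ∘ₗ connection p q

/-- The curvature `R̃(ξ, η) = [θ̃(ξ), θ̃(η)] - θ̃([ξ, η])` on invariant vector fields of
`G(ℝ)⁺ × z₀`, where `[(A, u), (B, u')] = ([A, B], 0)`. -/
def curvature {p q : ℕ} (ξ η : LieG p q × Z q) : LieG p q :=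
  bracket (connection p q ξ) (connection p q η) - connection p q (bracket ξ.1 η.1, 0)

/-- The element of `⋀² T*` given by an alternating bilinear form `β` on `T`. -/
def twoForm {T : Type} [AddCommGroup T] [Module ℝ T] [FiniteDimensional ℝ T] (β : T → T → ℝ) :
    Forms T :=
  (1 / 2 : ℝ) • ∑ a, ∑ b, β (Module.finBasis ℝ T a) (Module.finBasis ℝ T b) •
    (ExteriorAlgebra.ι ℝ ((Module.finBasis ℝ T).coord a) *
      ExteriorAlgebra.ι ℝ ((Module.finBasis ℝ T).coord b))

/-- The value at a point of `⊕ Ω̃^{i,j}`: the algebra `⋀ T* ⊗ ⋀ z₀` with the product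
`(ω ⊗ s) ∧ (η ⊗ t) = (-1)^{jk} (ω ∧ η) ⊗ (s ∧ t)` for `s` of degree `j` and `η` of degree `k`. -/
abbrev BiForms (T : Type) [AddCommGroup T] [Module ℝ T] (q : ℕ) : Type :=
  GradedTensorProduct ℝ (fun i : ℕ => ⋀[ℝ]^i (Module.Dual ℝ T)) (fun j : ℕ => ⋀[ℝ]^j (Z q))

/-- The element `ω ⊗ s`. -/
def biTmul {T : Type} [AddCommGroup T] [Module ℝ T] {q : ℕ} (ω : Forms T)
    (s : ExteriorAlgebra ℝ (Z q)) : BiForms T q :=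
  GradedTensorProduct.tmul ℝ ω s

/-- The basis vector `e_μ` of `z₀` in `⋀ z₀`. -/
def eVec {q : ℕ} (μ : Fin q) : ExteriorAlgebra ℝ (Z q) :=
  ExteriorAlgebra.ι ℝ (Pi.single μ 1 : Z q)

/-- A `z₀`-valued `1`-form as an element of bidegree `(1, 1)`. -/
def vectorForm {T : Type} [AddCommGroup T] [Module ℝ T] {q : ℕ} (L : T →ₗ[ℝ] Z q) : BiForms T q :=
  ∑ μ, biTmul (ExteriorAlgebra.ι ℝ (LinearMap.proj μ ∘ₗ L)) (eVec μ)

/-- The curvature `ρ(R̃)` as an element of bidegree `(2, 2)`, by the isomorphism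
`A ↦ ∑_{μ < ν} ⟨A e_μ, e_ν⟩ e_μ ∧ e_ν` of `𝔰𝔬(z₀)` with `⋀² z₀`. -/
def curvatureForm (p q : ℕ) : BiForms (LieG p q × Z q) q :=
  ∑ μ : Fin q, ∑ ν ∈ Finset.Ioi μ,
    biTmul (twoForm fun ξ η => fiberInner p (rhoLie p q (curvature ξ η) (Pi.single μ 1))
      (Pi.single ν 1)) (eVec μ * eVec ν)

open Classical in
/-- The exponential `∑ aᵏ / k!` in a finite-dimensional real algebra. Convergence is tested on the
linear functionals. -/
def algExp {A : Type} [Ring A] [Algebra ℝ A] (a : A) : A :=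
  if h : ∃ b : A, ∀ ℓ : Module.Dual ℝ A,
      HasSum (fun k : ℕ => (k.factorial : ℝ)⁻¹ * ℓ (a ^ k)) (ℓ b) then
    h.choose
  else 0

/-- The Berezin integral `s ↦ ⟨s, b₁ ∧ ⋯ ∧ b_q⟩` on `⋀ z₀`, for an oriented orthonormal basis `b` of
`z₀`. -/
def berezin (p : ℕ) {q : ℕ} (b : Fin q → Z q) : ExteriorAlgebra ℝ (Z q) →ₗ[ℝ] ℝ :=
  ExteriorAlgebra.liftAlternating (R := ℝ) (Pi.single q
    ((Matrix.detRowAlternating (R := ℝ) (n := Fin q)).compLinearMap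
      (LinearMap.pi fun j : Fin q =>
        ({ toFun := fun w => fiberInner p w (b j)
           map_add' := fun w w' => by
             simp only [fiberInner, map_add, form_add_left, neg_add]
           map_smul' := fun c w => by
             simp only [fiberInner, map_smul, form_smul_left, RingHom.id_apply, smul_eq_mul,
               mul_neg] } : Z q →ₗ[ℝ] ℝ))))

/-- The extended Berezin integral `ω ⊗ s ↦ (∫ᴮ s) ω`. -/
def berezinForm {T : Type} [AddCommGroup T] [Module ℝ T] (p : ℕ) {q : ℕ} (b : Fin q → Z q) :
    BiForms T q →ₗ[ℝ] Forms T :=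
  (TensorProduct.rid ℝ (Forms T)).toLinearMap ∘ₗ LinearMap.lTensor (Forms T) (berezin p b) ∘ₗ
    (GradedTensorProduct.of ℝ (fun i : ℕ => ⋀[ℝ]^i (Module.Dual ℝ T))
      (fun j : ℕ => ⋀[ℝ]^j (Z q))).symm.toLinearMap

/-- The function on `G(ℝ)⁺ × z₀` attached to the tautological section `𝐬[g, w] = [(g, w), w]`. -/
def tautological {p q : ℕ} (x : Gplus p q × Z q) : Z q := x.2

/-- The Mathai–Quillen form
`U_MQ = (-1)^{q(q+1)/2} (2π)^{-q/2} ∫ᴮ exp(-2π ‖𝐬‖² - 2√π ∇̃𝐬 + ρ(R̃))`, with `z₀` oriented by its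
orthonormal basis `b`. -/
def mathaiQuillen (p q : ℕ) (b : Fin q → Z q) (x : Gplus p q × Z q) : Forms (LieG p q × Z q) :=
  ((-1 : ℝ) ^ (q * (q + 1) / 2) * (2 * Real.pi) ^ (-(q : ℝ) / 2)) •
    berezinForm p b (algExp
      (-(2 * Real.pi * fiberInner p (tautological x) (tautological x)) •
          (1 : BiForms (LieG p q × Z q) q)
        - (2 * Real.sqrt Real.pi) • vectorForm (covariantDerivative tautological x)
        + curvatureForm p q))

/-! ## The Kudla–Millson form -/

/-- The Siegel majorant `Q⁺_{z₀}(v, v)`. -/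
def siegelMajorant {p q : ℕ} (v : V p q) : ℝ := ∑ i, v i ^ 2

lemma siegelMajorant_temperate (p q : ℕ) :
    Function.HasTemperateGrowth (fun v : V p q => -Real.pi * siegelMajorant v) := by
  unfold siegelMajorant
  have h : ∀ i, Function.HasTemperateGrowth (fun v : V p q => v i) := fun i =>
    (ContinuousLinearMap.proj (R := ℝ) (φ := fun _ : Fin p ⊕ Fin q => ℝ) i).hasTemperateGrowth
  exact (Function.HasTemperateGrowth.const _).mul
    (Function.HasTemperateGrowth.sum fun i _ => (h i).pow 2)

lemma norm_sq_le_siegelMajorant {p q : ℕ} (v : V p q) : ‖v‖ ^ 2 ≤ siegelMajorant v := by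
  have h0 : 0 ≤ siegelMajorant v := Finset.sum_nonneg fun i _ => sq_nonneg _
  rw [← Real.sqrt_le_sqrt_iff h0, Real.sqrt_sq (norm_nonneg _)]
  refine (pi_norm_le_iff_of_nonneg (Real.sqrt_nonneg _)).2 fun i => ?_
  rw [Real.norm_eq_abs]
  refine Real.abs_le_sqrt ?_
  exact Finset.single_le_sum (f := fun i => v i ^ 2) (fun i _ => sq_nonneg _) (Finset.mem_univ i)

lemma gaussian_decay (p q k n : ℕ) : ∃ C : ℝ, ∀ v : V p q, ‖v‖ ^ k *
    ‖iteratedFDeriv ℝ n (fun v : V p q => Real.exp (-Real.pi * siegelMajorant v)) v‖ ≤ C := by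
  have ht := siegelMajorant_temperate p q
  obtain ⟨m, C, hC, hb⟩ := ht.norm_iteratedFDeriv_le_uniform n
  set f : V p q → ℝ := fun v => -Real.pi * siegelMajorant v with hf
  have hD : ∀ v : V p q, ‖iteratedFDeriv ℝ n (fun v => Real.exp (f v)) v‖ ≤
      n.factorial * Real.exp (f v) * ((1 + C) * (1 + ‖v‖) ^ m) ^ n := by
    intro v
    refine norm_iteratedFDeriv_comp_le (g := Real.exp) (f := f) (N := (n : WithTop ℕ∞))
      Real.contDiff_exp (ht.1.of_le (by exact_mod_cast le_top)) le_rfl v ?_ ?_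
    · intro i _
      rw [norm_iteratedFDeriv_eq_norm_iteratedDeriv, iteratedDeriv_eq_iterate, Real.iter_deriv_exp,
        Real.norm_eq_abs, abs_of_pos (Real.exp_pos _)]
    · intro i hi hin
      have h1 : (1 : ℝ) ≤ (1 + ‖v‖) ^ m := one_le_pow₀ (by linarith [norm_nonneg v])
      have h2 : 1 ≤ (1 + C) * (1 + ‖v‖) ^ m := by nlinarith
      calc _ ≤ C * (1 + ‖v‖) ^ m := hb i hin v
        _ ≤ (1 + C) * (1 + ‖v‖) ^ m := by nlinarith
        _ ≤ _ := le_self_pow₀ h2 (by omega)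
  refine ⟨n.factorial * (1 + C) ^ n * ((k + m * n).factorial * Real.exp 2), fun v => ?_⟩
  have h3 : Real.exp (f v) ≤ Real.exp (-‖v‖ ^ 2) := by
    refine Real.exp_le_exp.2 ?_
    have := norm_sq_le_siegelMajorant v
    have := Real.pi_gt_three
    simp only [hf]
    nlinarith [sq_nonneg ‖v‖]
  have h4 : (1 + ‖v‖) ^ (k + m * n) ≤ (k + m * n).factorial * Real.exp (1 + ‖v‖) := by
    have := Real.pow_div_factorial_le_exp (1 + ‖v‖) (by positivity) (k + m * n)
    rwa [div_le_iff₀' (by positivity)] at this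
  have h5 : Real.exp (1 + ‖v‖) * Real.exp (-‖v‖ ^ 2) ≤ Real.exp 2 := by
    rw [← Real.exp_add]
    refine Real.exp_le_exp.2 ?_
    nlinarith [sq_nonneg (‖v‖ - 1 / 2)]
  calc ‖v‖ ^ k * ‖iteratedFDeriv ℝ n (fun v => Real.exp (f v)) v‖
      ≤ (1 + ‖v‖) ^ k * (n.factorial * Real.exp (-‖v‖ ^ 2) * ((1 + C) * (1 + ‖v‖) ^ m) ^ n) := by
        gcongr
        · linarith
        · exact (hD v).trans (by gcongr)
    _ = n.factorial * (1 + C) ^ n * ((1 + ‖v‖) ^ (k + m * n) * Real.exp (-‖v‖ ^ 2)) := by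
        rw [mul_pow, ← pow_mul, pow_add]; ring
    _ ≤ n.factorial * (1 + C) ^ n *
        (((k + m * n).factorial * Real.exp (1 + ‖v‖)) * Real.exp (-‖v‖ ^ 2)) := by gcongr
    _ ≤ _ := by
        rw [mul_assoc ((k + m * n).factorial : ℝ)]
        gcongr

/-- The Gaussian `exp(-π Q⁺_{z₀}(v, v))` as a Schwartz function. -/
def gaussian (p q : ℕ) : 𝓢(V p q, ℝ) where
  toFun v := Real.exp (-Real.pi * siegelMajorant v)
  smooth' := by unfold siegelMajorant; fun_prop
  decay' := gaussian_decay p q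

/-- The linear form `ω_{αμ}` on `𝔤`, from the basis dual to the `X_{ij} = T(e_i ∧ e_j)`, where
`X_{αμ} = E_{αμ} + E_{μα}`. -/
def omega {p q : ℕ} (α : Fin p) (μ : Fin q) : Module.Dual ℝ (LieG p q) where
  toFun A := A.1 (Sum.inl α) (Sum.inr μ)
  map_add' _ _ := rfl
  map_smul' _ _ := rfl

/-- The operator `x_α - (1/2π) ∂/∂x_α` on Schwartz functions. -/
def creation {p q : ℕ} (α : Fin p) : 𝓢(V p q, ℝ) →ₗ[ℝ] 𝓢(V p q, ℝ) :=
  (SchwartzMap.smulLeftCLM ℝ (fun v : V p q => v (Sum.inl α))).toLinearMap -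
    (1 / (2 * Real.pi)) •
      (LineDeriv.lineDerivOpCLM ℝ 𝓢(V p q, ℝ) (Pi.single (Sum.inl α) 1 : V p q)).toLinearMap

/-- The Howe operator `2^{-q} ∏_μ ∑_α A_{αμ} ⊗ (x_α - (1/2π) ∂/∂x_α)`, the factors composed in the
order of the indices `μ`, where `A_{αμ}` is left multiplication by `ω_{αμ}`. -/
def howe (p q : ℕ) : Module.End ℝ (Forms (LieG p q) ⊗[ℝ] 𝓢(V p q, ℝ)) :=
  (1 / 2 ^ q : ℝ) • (List.ofFn fun μ : Fin q => ∑ α : Fin p,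
    (TensorProduct.map (LinearMap.mulLeft ℝ (ExteriorAlgebra.ι ℝ (omega α μ))) (creation α) :
      Module.End ℝ (Forms (LieG p q) ⊗[ℝ] 𝓢(V p q, ℝ)))).prod

/-- The value at `v` of an element of `⋀ 𝔤* ⊗ 𝓢(V(ℝ))`. -/
def evalAt {p q : ℕ} (v : V p q) : Forms (LieG p q) ⊗[ℝ] 𝓢(V p q, ℝ) →ₗ[ℝ] Forms (LieG p q) :=
  (TensorProduct.rid ℝ (Forms (LieG p q))).toLinearMap ∘ₗ
    LinearMap.lTensor (Forms (LieG p q))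
      ({ toFun := fun f => f v
         map_add' := fun _ _ => rfl
         map_smul' := fun _ _ => rfl } : 𝓢(V p q, ℝ) →ₗ[ℝ] ℝ)

/-- The value `φ_KM(v)_e` at the base point. -/
def kudlaMillsonBase {p q : ℕ} (v : V p q) : Forms (LieG p q) :=
  evalAt v (howe p q (1 ⊗ₜ[ℝ] gaussian p q))

/-- The form `φ_KM(v)` on `𝔻⁺`: the extension of `φ_KM(v)_e` by the `G(ℝ)⁺`-invariance
`L_g^* φ_KM(v) = φ_KM(g⁻¹ v)`. -/
def kudlaMillson {p q : ℕ} (v : V p q) (g : Gplus p q) : Forms (LieG p q) :=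
  kudlaMillsonBase (act g⁻¹ v)

/-- The stabilizer `Γ_v` of `v` in `Γ`. -/
def stabilizerIn {p q : ℕ} (Γ : Subgroup (Gplus p q)) (v : V p q) : Subgroup (Gplus p q) where
  carrier := {γ | γ ∈ Γ ∧ act γ v = v}
  mul_mem' {a b} ha hb := ⟨mul_mem ha.1 hb.1, by rw [act_mul, hb.2, ha.2]⟩
  one_mem' := ⟨one_mem _, act_one v⟩
  inv_mem' {a} ha := ⟨inv_mem ha.1, by
    have h := act_inv_act a v
    rwa [ha.2] at h⟩

end

end KudlaMillson

/-! On a tangent vector `A ∈ 𝔭` the covariant derivative of the tautological section pulls back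
under `s_v` to `-pr(A u⁺)`, where `u = g⁻¹ v` and `u⁺` is the projection of `u` to
`⟨e_1, …, e_p⟩`, and the curvature is `-½ ∑_α L_α²` for the `z₀`-valued `1`-forms
`L_α = ∑_μ ω_{αμ} ⊗ e_μ`. Hence the exponent of `s_v^* U_MQ` is, up to a scalar,
`2√π ∑_α u_α L_α - ½ ∑_α L_α²`, in an algebra generated by the commuting nilpotent elements
`ω_{αμ} ⊗ e_μ`. Build this exponent up one index `μ` at a time: adding `m` to a set `S` of indices
adds the element `∑_α (ω_{αm} ⊗ e_m) (2√π u_α - ∑_{μ ∈ S} ω_{αμ} ⊗ e_μ)` of square zero, and the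
second factor is what `√π (x_α - (1/2π) ∂/∂x_α)` produces from the Gaussian times the exponential
over `S`. So the Gaussian times the full exponential is the product over `m` of
`1 + √π ∑_α (ω_{αm} ⊗ e_m) ⊗ (x_α - (1/2π) ∂/∂x_α)` applied to the Gaussian, and the Berezin
integral picks out the term in which all `q` factors contribute, which is `φ_KM`.

That the forms descend to `E` and `𝔻⁺` rests on `det ρ(k) = 1` for `k ∈ K`: the determinant of the
lower right block is nonzero on `O(p, q)`, hence positive on the identity component. -/

namespace KudlaMillson

noncomputable section

/-! ## Exponentials of nilpotent elements -/

section Exponential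

variable {A B : Type} [Ring A] [Algebra ℝ A] [Ring B] [Algebra ℝ B]

lemma algExp_eq_of_hasSum {a b : A} (h : ∀ ℓ : Module.Dual ℝ A,
    HasSum (fun k : ℕ => (k.factorial : ℝ)⁻¹ * ℓ (a ^ k)) (ℓ b)) : algExp a = b := by
  have converges : ∃ b : A, ∀ ℓ : Module.Dual ℝ A,
      HasSum (fun k : ℕ => (k.factorial : ℝ)⁻¹ * ℓ (a ^ k)) (ℓ b) := ⟨b, h⟩
  rw [algExp, dif_pos converges, ← sub_eq_zero, ← Module.forall_dual_apply_eq_zero_iff ℝ]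
  intro ℓ
  rw [map_sub, (converges.choose_spec ℓ).unique (h ℓ), sub_self]

lemma hasSum_inv_factorial_mul_apply_pow {a : A} {N : ℕ} (h : a ^ N = 0) (ℓ : Module.Dual ℝ A) :
    HasSum (fun k : ℕ => (k.factorial : ℝ)⁻¹ * ℓ (a ^ k))
      (ℓ (∑ k ∈ Finset.range N, (k.factorial : ℝ)⁻¹ • a ^ k)) := by
  simp only [map_sum, map_smul, smul_eq_mul]
  refine hasSum_sum_of_ne_finset_zero fun k hk => ?_
  rw [pow_eq_zero_of_le (by simpa using hk) h, map_zero, mul_zero]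

lemma algExp_eq_sum_of_pow_eq_zero {a : A} {N : ℕ} (h : a ^ N = 0) :
    algExp a = ∑ k ∈ Finset.range N, (k.factorial : ℝ)⁻¹ • a ^ k :=
  algExp_eq_of_hasSum (hasSum_inv_factorial_mul_apply_pow h)

lemma algExp_eq_isNilpotent_exp [Module ℚ A] {a : A} (ha : IsNilpotent a) :
    algExp a = IsNilpotent.exp a := by
  obtain ⟨N, hN⟩ := ha
  rw [algExp_eq_sum_of_pow_eq_zero hN, IsNilpotent.exp_eq_sum hN]
  refine Finset.sum_congr rfl fun k _ => ?_
  rw [← Rat.cast_smul_eq_qsmul ℝ, Rat.cast_inv, Rat.cast_natCast]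

lemma algExp_add_of_commute {a b : A} (h : Commute a b) (ha : IsNilpotent a)
    (hb : IsNilpotent b) : algExp (a + b) = algExp a * algExp b := by
  let _ : Module ℚ A := Module.compHom A (algebraMap ℚ ℝ)
  rw [algExp_eq_isNilpotent_exp ha, algExp_eq_isNilpotent_exp hb,
    algExp_eq_isNilpotent_exp (h.isNilpotent_add ha hb), IsNilpotent.exp_add_of_commute h ha hb]

lemma map_algExp (f : A →ₐ[ℝ] B) {a : A} (ha : IsNilpotent a) :
    f (algExp a) = algExp (f a) := by
  obtain ⟨N, hN⟩ := ha
  rw [algExp_eq_sum_of_pow_eq_zero hN,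
    algExp_eq_sum_of_pow_eq_zero (a := f a) (by rw [← map_pow, hN, map_zero])]
  simp only [map_sum, map_smul, map_pow]

lemma algExp_mem {S : Subalgebra ℝ A} {a : A} (ha : IsNilpotent a) (h : a ∈ S) :
    algExp a ∈ S := by
  obtain ⟨N, hN⟩ := ha
  rw [algExp_eq_sum_of_pow_eq_zero hN]
  exact sum_mem fun k _ => S.smul_mem (S.pow_mem h k) _

lemma algExp_of_mul_self_eq_zero {a : A} (h : a * a = 0) : algExp a = 1 + a := by
  rw [algExp_eq_sum_of_pow_eq_zero (N := 2) (by rw [pow_two, h])]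
  simp [Finset.sum_range_succ]

lemma inv_factorial_mul_apply_smul_one_add_pow (c : ℝ) (a : A) (ℓ : Module.Dual ℝ A) (k : ℕ) :
    (k.factorial : ℝ)⁻¹ * ℓ ((c • (1 : A) + a) ^ k) =
      ∑ m ∈ Finset.HasAntidiagonal.antidiagonal k,
        c ^ m.1 / m.1.factorial * ((m.2.factorial : ℝ)⁻¹ * ℓ (a ^ m.2)) := by
  rw [((Commute.one_left a).smul_left c).add_pow', map_sum, Finset.mul_sum]
  refine Finset.sum_congr rfl fun m hm => ?_
  rw [smul_pow, one_pow, smul_mul_assoc, one_mul, map_nsmul, map_smul, nsmul_eq_mul, smul_eq_mul,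
    ← Finset.HasAntidiagonal.mem_antidiagonal.1 hm, Nat.cast_add_choose]
  have := Nat.cast_ne_zero (R := ℝ).2 (Nat.factorial_ne_zero (m.1 + m.2))
  field_simp

lemma algExp_smul_one_add (c : ℝ) {a : A} (ha : IsNilpotent a) :
    algExp (c • (1 : A) + a) = Real.exp c • algExp a := by
  obtain ⟨N, hN⟩ := ha
  refine algExp_eq_of_hasSum fun ℓ => ?_
  have sum_c : HasSum (fun k : ℕ => c ^ k / k.factorial) (Real.exp c) := by
    rw [Real.exp_eq_exp_ℝ]; exact NormedSpace.expSeries_div_hasSum_exp c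
  have sum_a := hasSum_inv_factorial_mul_apply_pow hN ℓ
  have cauchy := (summable_norm_sum_mul_antidiagonal_of_summable_norm
    sum_c.summable.norm sum_a.summable.norm).of_norm.hasSum
  rw [← tsum_mul_tsum_eq_tsum_sum_antidiagonal_of_summable_norm
    sum_c.summable.norm sum_a.summable.norm, sum_c.tsum_eq, sum_a.tsum_eq] at cauchy
  simpa only [inv_factorial_mul_apply_smul_one_add_pow, algExp_eq_sum_of_pow_eq_zero hN, map_smul,
    smul_eq_mul] using cauchy

lemma hasDerivAt_zero_sum_range_pow_mul (c : ℕ → ℝ) (N : ℕ) :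
    HasDerivAt (fun t : ℝ => ∑ k ∈ Finset.range (N + 2), t ^ k * c k) (c 1) 0 := by
  refine (HasDerivAt.fun_sum fun k _ => (hasDerivAt_pow k (0 : ℝ)).mul_const (c k)).congr_deriv ?_
  rw [Finset.sum_eq_single_of_mem 1 (by simp)]
  · simp
  · rintro (_ | _ | k) _ hk
    · simp
    · exact absurd rfl hk
    · simp

lemma hasDerivAt_apply_mul_algExp_smul (x : A) {a : A} (ha : IsNilpotent a)
    (ℓ : Module.Dual ℝ A) : HasDerivAt (fun t : ℝ => ℓ (x * algExp (t • a))) (ℓ (x * a)) 0 := by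
  obtain ⟨N, hN⟩ := ha
  have expand : ∀ t : ℝ, ℓ (x * algExp (t • a)) =
      ∑ k ∈ Finset.range (N + 2), t ^ k * ((k.factorial : ℝ)⁻¹ * ℓ (x * a ^ k)) := by
    intro t
    rw [algExp_eq_sum_of_pow_eq_zero (N := N + 2)
      (by rw [smul_pow, pow_add a, hN, zero_mul, smul_zero]), Finset.mul_sum, map_sum]
    refine Finset.sum_congr rfl fun k _ => ?_
    rw [smul_pow, smul_smul, mul_smul_comm, map_smul, smul_eq_mul]
    ring
  simp_rw [expand]
  simpa using hasDerivAt_zero_sum_range_pow_mul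
    (fun k => (k.factorial : ℝ)⁻¹ * ℓ (x * a ^ k)) N

lemma sum_pow_card_succ_eq_zero {R ι : Type*} [Ring R] (s : Finset ι) (y : ι → R)
    (hc : ∀ i j, Commute (y i) (y j)) (hy : ∀ i, y i * y i = 0) :
    (∑ i ∈ s, y i) ^ (s.card + 1) = 0 := by
  classical
  induction s using Finset.induction_on with
  | empty => simp
  | insert i s hi ih =>
    rw [Finset.sum_insert hi, Finset.card_insert_of_notMem hi]
    exact (Commute.sum_right _ _ _ fun j _ =>
      hc i j).add_pow_eq_zero_of_add_le_succ_of_pow_eq_zero (by rw [pow_two, hy]) ih (by omega)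

end Exponential

/-! ## Exterior algebras -/

section ExteriorAlgebra

variable {R M N : Type*} [CommRing R] [AddCommGroup M] [Module R M] [AddCommGroup N] [Module R N]

lemma ι_mem_exteriorPower_one (m : M) : ExteriorAlgebra.ι R m ∈ ⋀[R]^1 M := by
  rw [ExteriorAlgebra.exteriorPower, pow_one]
  exact LinearMap.mem_range_self _ m

lemma ι_mul_ι_swap (m m' : M) : ExteriorAlgebra.ι R m * ExteriorAlgebra.ι R m' =
    -(ExteriorAlgebra.ι R m' * ExteriorAlgebra.ι R m) :=
  eq_neg_of_add_eq_zero_left (ExteriorAlgebra.ι_add_mul_swap m m')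

lemma map_mem_exteriorPower (f : M →ₗ[R] N) {k : ℕ} {x : ExteriorAlgebra R M}
    (hx : x ∈ ⋀[R]^k M) : ExteriorAlgebra.map f x ∈ ⋀[R]^k N := by
  suffices h : (⋀[R]^k M).map (ExteriorAlgebra.map f).toLinearMap ≤ ⋀[R]^k N from h ⟨x, hx, rfl⟩
  rw [ExteriorAlgebra.exteriorPower, Submodule.map_pow]
  refine pow_le_pow_left' ?_ k
  rintro _ ⟨_, ⟨m, rfl⟩, rfl⟩
  exact ⟨f m, by simp⟩

end ExteriorAlgebra

/-! ## Forms and their interior products -/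

section Forms

variable {T T' T'' : Type} [AddCommGroup T] [Module ℝ T] [AddCommGroup T'] [Module ℝ T']
  [AddCommGroup T''] [Module ℝ T'']

lemma pullbackLin_ι (L : T →ₗ[ℝ] T') (a : Module.Dual ℝ T') :
    pullbackLin L (ExteriorAlgebra.ι ℝ a) = ExteriorAlgebra.ι ℝ (a ∘ₗ L) :=
  ExteriorAlgebra.map_apply_ι _ _

lemma pullbackLin_pullbackLin (L : T →ₗ[ℝ] T') (L' : T' →ₗ[ℝ] T'') (ω : Forms T'') :
    pullbackLin L (pullbackLin L' ω) = pullbackLin (L' ∘ₗ L) ω :=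
  DFunLike.congr_fun (ExteriorAlgebra.map_comp_map L'.dualMap L.dualMap) ω

lemma pullbackLin_mem_exteriorPower (L : T →ₗ[ℝ] T') {k : ℕ} {ω : Forms T'}
    (hω : ω ∈ ⋀[ℝ]^k (Module.Dual ℝ T')) : pullbackLin L ω ∈ ⋀[ℝ]^k (Module.Dual ℝ T) :=
  map_mem_exteriorPower _ hω

lemma interior_ι_mul (ξ : T) (a : Module.Dual ℝ T) (ω : Forms T) :
    interior ξ (ExteriorAlgebra.ι ℝ a * ω) =
      a ξ • ω - ExteriorAlgebra.ι ℝ a * interior ξ ω :=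
  CliffordAlgebra.contractLeft_ι_mul (Module.Dual.eval ℝ T ξ) a ω

lemma interior_algebraMap (ξ : T) (r : ℝ) : interior ξ (algebraMap ℝ (Forms T) r) = 0 :=
  CliffordAlgebra.contractLeft_algebraMap _ _ r

lemma interior_pullbackLin (L : T →ₗ[ℝ] T') (ξ : T) (ω : Forms T') :
    interior ξ (pullbackLin L ω) = pullbackLin L (interior (L ξ) ω) := by
  induction ω using CliffordAlgebra.left_induction with
  | algebraMap r =>
    change interior ξ (pullbackLin L (algebraMap ℝ (Forms T') r)) =
      pullbackLin L (interior (L ξ) (algebraMap ℝ (Forms T') r))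
    rw [AlgHom.commutes, interior_algebraMap, interior_algebraMap, map_zero]
  | add ω η hω hη => simp only [map_add, hω, hη]
  | ι_mul ω a hω =>
    change interior ξ (pullbackLin L (ExteriorAlgebra.ι ℝ a * ω)) =
      pullbackLin L (interior (L ξ) (ExteriorAlgebra.ι ℝ a * ω))
    simp only [map_mul, map_sub, map_smul, pullbackLin_ι, interior_ι_mul, hω, LinearMap.comp_apply]

lemma interior_eq_zero_of_mem_map_ι_pow {ξ : T} {M : Submodule ℝ (Module.Dual ℝ T)}
    (h : ∀ a ∈ M, a ξ = 0) {k : ℕ} {ω : Forms T}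
    (hω : ω ∈ (M.map (ExteriorAlgebra.ι ℝ)) ^ k) : interior ξ ω = 0 := by
  induction hω using Submodule.pow_induction_on_left' with
  | algebraMap r => exact interior_algebraMap ξ r
  | add ω η i _ _ hω hη => rw [map_add, hω, hη, add_zero]
  | mem_mul m hm _ ω _ ih =>
    obtain ⟨a, ha, rfl⟩ := hm
    rw [interior_ι_mul, h a ha, ih, zero_smul, mul_zero, sub_zero]

variable [FiniteDimensional ℝ T]

lemma sum_smul_ι_coord_mul_ι_coord (a b : Module.Dual ℝ T) :
    ∑ k, ∑ l, (a (Module.finBasis ℝ T k) * b (Module.finBasis ℝ T l)) •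
        (ExteriorAlgebra.ι ℝ ((Module.finBasis ℝ T).coord k) *
          ExteriorAlgebra.ι ℝ ((Module.finBasis ℝ T).coord l)) =
      ExteriorAlgebra.ι ℝ a * ExteriorAlgebra.ι ℝ b := by
  conv_rhs => rw [← (Module.finBasis ℝ T).sum_dual_apply_smul_coord a,
    ← (Module.finBasis ℝ T).sum_dual_apply_smul_coord b]
  simp only [map_sum, map_smul, Finset.sum_mul_sum, smul_mul_smul_comm]

lemma twoForm_mul_sub_mul (a b : Module.Dual ℝ T) :
    (twoForm fun ξ η => a ξ * b η - b ξ * a η) =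
      ExteriorAlgebra.ι ℝ a * ExteriorAlgebra.ι ℝ b := by
  simp only [twoForm, sub_smul, Finset.sum_sub_distrib, sum_smul_ι_coord_mul_ι_coord]
  rw [ι_mul_ι_swap b, sub_neg_eq_add, ← two_smul ℝ, smul_smul]
  norm_num

lemma twoForm_sum {ι : Type*} (s : Finset ι) (β : ι → T → T → ℝ) :
    (twoForm fun ξ η => ∑ i ∈ s, β i ξ η) = ∑ i ∈ s, twoForm (β i) := by
  simp only [twoForm, Finset.sum_smul, ← Finset.smul_sum]
  rw [Finset.sum_congr rfl fun k _ => Finset.sum_comm, Finset.sum_comm]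

end Forms

/-! ## The bigraded algebra -/

section BiForms

variable {T T' : Type} [AddCommGroup T] [Module ℝ T] [AddCommGroup T'] [Module ℝ T'] {q r : ℕ}

/-- The map `(ω, s) ↦ ω ⊗ s` as a bilinear map, so that `biTmul` inherits its linearity. -/
def biTmulₗ (T : Type) [AddCommGroup T] [Module ℝ T] (q : ℕ) :
    Forms T →ₗ[ℝ] ExteriorAlgebra ℝ (Z q) →ₗ[ℝ] BiForms T q :=
  LinearMap.mk₂ ℝ biTmul TensorProduct.add_tmul TensorProduct.smul_tmul' TensorProduct.tmul_add
    TensorProduct.tmul_smul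

lemma biTmulₗ_apply (ω : Forms T) (s : ExteriorAlgebra ℝ (Z q)) :
    biTmulₗ T q ω s = biTmul ω s := rfl

lemma biTmul_one_one : biTmul (1 : Forms T) (1 : ExteriorAlgebra ℝ (Z q)) = 1 := rfl

lemma neg_one_units_pow_smul {M : Type*} [AddCommGroup M] [Module ℝ M] (n : ℕ) (x : M) :
    (-1 : ℤˣ) ^ n • x = (-1 : ℝ) ^ n • x := by
  rcases n.even_or_odd with h | h
  · rw [h.neg_one_pow, h.neg_one_pow, one_smul, one_smul]
  · rw [h.neg_one_pow, h.neg_one_pow, neg_one_smul, Units.neg_smul, one_smul]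

lemma biTmul_mul_biTmul {j k : ℕ} (ω : Forms T) {s : ExteriorAlgebra ℝ (Z q)}
    (hs : s ∈ ⋀[ℝ]^j (Z q)) {η : Forms T} (hη : η ∈ ⋀[ℝ]^k (Module.Dual ℝ T))
    (t : ExteriorAlgebra ℝ (Z q)) :
    biTmul ω s * biTmul η t = (-1 : ℝ) ^ (j * k) • biTmul (ω * η) (s * t) :=
  (GradedTensorProduct.tmul_coe_mul_coe_tmul (R := ℝ) (fun i : ℕ => ⋀[ℝ]^i (Module.Dual ℝ T))
    (fun j : ℕ => ⋀[ℝ]^j (Z q)) ω ⟨s, hs⟩ ⟨η, hη⟩ t).trans (neg_one_units_pow_smul _ _)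

lemma biTmul_one_mul_one_biTmul (ω : Forms T) (s : ExteriorAlgebra ℝ (Z q)) :
    biTmul ω 1 * biTmul 1 s = biTmul ω s :=
  GradedTensorProduct.tmul_one_mul_one_tmul (R := ℝ) (fun i : ℕ => ⋀[ℝ]^i (Module.Dual ℝ T))
    (fun j : ℕ => ⋀[ℝ]^j (Z q)) ω s

@[elab_as_elim]
lemma BiForms.induction {C : BiForms T q → Prop} (zero : C 0) (tmul : ∀ ω s, C (biTmul ω s))
    (add : ∀ x y, C x → C y → C (x + y)) (x : BiForms T q) : C x :=
  TensorProduct.induction_on (motive := C) x zero tmul add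

/-- The generators `a ⊗ z` of bidegree `(1, 1)`, bilinear in `a ∈ T*` and `z ∈ z₀`. Their two signs
cancel, so they commute, and every exponential of the development lives in the commutative
subalgebra that they generate. -/
def gen : Module.Dual ℝ T →ₗ[ℝ] Z q →ₗ[ℝ] BiForms T q :=
  (biTmulₗ T q).compl₁₂ (ExteriorAlgebra.ι ℝ) (ExteriorAlgebra.ι ℝ)

lemma gen_apply (a : Module.Dual ℝ T) (z : Z q) :
    gen a z = biTmul (ExteriorAlgebra.ι ℝ a) (ExteriorAlgebra.ι ℝ z) := rfl

lemma gen_mul_biTmul (a : Module.Dual ℝ T) (z : Z q) {k : ℕ} {η : Forms T}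
    (hη : η ∈ ⋀[ℝ]^k (Module.Dual ℝ T)) (t : ExteriorAlgebra ℝ (Z q)) :
    gen a z * biTmul η t =
      (-1 : ℝ) ^ k • biTmul (ExteriorAlgebra.ι ℝ a * η) (ExteriorAlgebra.ι ℝ z * t) := by
  rw [gen_apply, biTmul_mul_biTmul _ (ι_mem_exteriorPower_one z) hη, one_mul]

lemma gen_mul_gen (a a' : Module.Dual ℝ T) (z z' : Z q) :
    gen a z * gen a' z' = -biTmul (ExteriorAlgebra.ι ℝ a * ExteriorAlgebra.ι ℝ a')
      (ExteriorAlgebra.ι ℝ z * ExteriorAlgebra.ι ℝ z') := by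
  rw [gen_apply a', gen_mul_biTmul _ _ (ι_mem_exteriorPower_one a'), pow_one, neg_one_smul]

lemma gen_commute (a a' : Module.Dual ℝ T) (z z' : Z q) : Commute (gen a z) (gen a' z') := by
  rw [Commute, SemiconjBy, gen_mul_gen, gen_mul_gen, ι_mul_ι_swap a, ι_mul_ι_swap z]
  simp only [← biTmulₗ_apply, map_neg, LinearMap.neg_apply, neg_neg]

lemma gen_mul_gen_self_right (a a' : Module.Dual ℝ T) (z : Z q) : gen a z * gen a' z = 0 := by
  rw [gen_mul_gen, ExteriorAlgebra.ι_sq_zero, ← biTmulₗ_apply, map_zero, neg_zero]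

/-- The commutative subalgebra generated by the `a ⊗ z` with `a` in a space `M` of linear forms.
The choice of `M` records on which tangent vectors its elements vanish. -/
def genAlg (q : ℕ) (M : Submodule ℝ (Module.Dual ℝ T)) : Subalgebra ℝ (BiForms T q) :=
  Algebra.adjoin ℝ {x | ∃ a ∈ M, ∃ z : Z q, x = gen a z}

lemma gen_mem_genAlg {M : Submodule ℝ (Module.Dual ℝ T)} {a : Module.Dual ℝ T} (ha : a ∈ M)
    (z : Z q) : gen a z ∈ genAlg q M := Algebra.subset_adjoin ⟨a, ha, z, rfl⟩

lemma commute_of_mem_genAlg {M : Submodule ℝ (Module.Dual ℝ T)} {x y : BiForms T q}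
    (hx : x ∈ genAlg q M) (hy : y ∈ genAlg q M) : Commute x y := by
  refine Algebra.commute_of_mem_adjoin_of_forall_mem_commute hy ?_
  rintro _ ⟨a, -, z, rfl⟩
  refine (Algebra.commute_of_mem_adjoin_of_forall_mem_commute hx ?_).symm
  rintro _ ⟨a', -, z', rfl⟩
  exact gen_commute _ _ _ _

lemma vectorForm_eq_sum_gen (L : T →ₗ[ℝ] Z q) :
    vectorForm L = ∑ μ, gen (LinearMap.proj μ ∘ₗ L) (Pi.single μ 1 : Z q) := rfl

/-- `vectorForm` as a linear map. -/
def vectorFormₗ (T : Type) [AddCommGroup T] [Module ℝ T] (q : ℕ) :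
    (T →ₗ[ℝ] Z q) →ₗ[ℝ] BiForms T q where
  toFun := vectorForm
  map_add' L L' := by
    simp only [vectorForm_eq_sum_gen, LinearMap.comp_add, map_add, LinearMap.add_apply,
      Finset.sum_add_distrib]
  map_smul' c L := by
    simp only [vectorForm_eq_sum_gen, LinearMap.comp_smul, map_smul, LinearMap.smul_apply,
      Finset.smul_sum, RingHom.id_apply]

lemma vectorFormₗ_apply (L : T →ₗ[ℝ] Z q) : vectorFormₗ T q L = vectorForm L := rfl

lemma vectorForm_mem_genAlg {M : Submodule ℝ (Module.Dual ℝ T)} {L : T →ₗ[ℝ] Z q}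
    (h : ∀ μ, LinearMap.proj μ ∘ₗ L ∈ M) : vectorForm L ∈ genAlg q M :=
  sum_mem fun μ _ => gen_mem_genAlg (h μ) _

lemma vectorForm_mem_genAlg_top (L : T →ₗ[ℝ] Z q) : vectorForm L ∈ genAlg q ⊤ :=
  vectorForm_mem_genAlg fun _ => trivial

lemma vectorForm_commute (L L' : T →ₗ[ℝ] Z q) : Commute (vectorForm L) (vectorForm L') :=
  commute_of_mem_genAlg (vectorForm_mem_genAlg_top L) (vectorForm_mem_genAlg_top L')

lemma vectorForm_pow_eq_zero (L : T →ₗ[ℝ] Z q) : vectorForm L ^ (q + 1) = 0 := by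
  have h := sum_pow_card_succ_eq_zero (Finset.univ : Finset (Fin q))
    (fun μ => gen (LinearMap.proj μ ∘ₗ L) (Pi.single μ 1 : Z q))
    (fun _ _ => gen_commute _ _ _ _) (fun _ => gen_mul_gen_self_right _ _ _)
  rwa [Finset.card_univ, Fintype.card_fin] at h

/-- The algebra homomorphism `L^* ⊗ ⋀ N` induced by linear maps of tangent spaces and fibers. -/
def biMap (L : T →ₗ[ℝ] T') (N : Z q →ₗ[ℝ] Z r) : BiForms T' q →ₐ[ℝ] BiForms T r :=
  GradedTensorProduct.lift (R := ℝ) (fun i : ℕ => ⋀[ℝ]^i (Module.Dual ℝ T'))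
    (fun j : ℕ => ⋀[ℝ]^j (Z q))
    ((GradedTensorProduct.includeLeft (fun i : ℕ => ⋀[ℝ]^i (Module.Dual ℝ T))
      (fun j : ℕ => ⋀[ℝ]^j (Z r))).comp (pullbackLin L))
    ((GradedTensorProduct.includeRight (fun i : ℕ => ⋀[ℝ]^i (Module.Dual ℝ T))
      (fun j : ℕ => ⋀[ℝ]^j (Z r))).comp (ExteriorAlgebra.map N))
    fun i j ω s => by
      refine (biTmul_one_mul_one_biTmul _ _).trans (Eq.trans ?_ (congrArg
        (fun x => (-1 : ℤˣ) ^ (j * i) • x) (biTmul_mul_biTmul (1 : Forms T)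
          (map_mem_exteriorPower N s.2) (pullbackLin_mem_exteriorPower L ω.2) 1).symm))
      rw [neg_one_units_pow_smul, smul_smul, ← mul_pow, neg_one_mul, neg_neg, one_pow, one_smul,
        one_mul, mul_one]
      rfl

lemma biMap_biTmul (L : T →ₗ[ℝ] T') (N : Z q →ₗ[ℝ] Z r) (ω : Forms T')
    (s : ExteriorAlgebra ℝ (Z q)) :
    biMap L N (biTmul ω s) = biTmul (pullbackLin L ω) (ExteriorAlgebra.map N s) :=
  biTmul_one_mul_one_biTmul _ _

lemma biMap_gen (L : T →ₗ[ℝ] T') (N : Z q →ₗ[ℝ] Z r) (a : Module.Dual ℝ T') (z : Z q) :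
    biMap L N (gen a z) = gen (a ∘ₗ L) (N z) := by
  rw [gen_apply, biMap_biTmul, pullbackLin_ι, ExteriorAlgebra.map_apply_ι, gen_apply]

lemma biMap_vectorForm (L : T →ₗ[ℝ] T') (N : Z q →ₗ[ℝ] Z r) (F : T' →ₗ[ℝ] Z q) :
    biMap L N (vectorForm F) = vectorForm (N ∘ₗ F ∘ₗ L) := by
  have N_single : ∀ μ, N (Pi.single μ 1) = ∑ ν, N (Pi.single μ 1) ν • (Pi.single ν 1 : Z r) :=
    fun μ => pi_eq_sum_univ' _
  have proj_comp : ∀ ν, LinearMap.proj ν ∘ₗ N ∘ₗ F ∘ₗ L =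
      ∑ μ, N (Pi.single μ 1) ν • ((LinearMap.proj μ ∘ₗ F) ∘ₗ L : Module.Dual ℝ T) := by
    intro ν
    ext ξ
    simpa [mul_comm] using congrFun (congrArg N (pi_eq_sum_univ' (F (L ξ)))) ν
  simp_rw [vectorForm_eq_sum_gen, map_sum, biMap_gen, proj_comp, map_sum, LinearMap.sum_apply]
  rw [Finset.sum_comm]
  refine Finset.sum_congr rfl fun μ _ => ?_
  conv_lhs => rw [N_single μ]
  simp only [map_sum, map_smul, LinearMap.smul_apply]

end BiForms

/-! ## The Berezin integral -/

section Berezin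

variable {T T' : Type} [AddCommGroup T] [Module ℝ T] [AddCommGroup T'] [Module ℝ T'] {q : ℕ}
  (p : ℕ) (b : Fin q → Z q)

lemma fiberInner_eq_sum (w w' : Z q) : fiberInner p w w' = ∑ μ, w μ * w' μ := by
  simp [fiberInner, form, incl]

lemma berezin_ιMulti (z : Fin q → Z q) :
    berezin p b (ExteriorAlgebra.ιMulti ℝ q z) =
      Matrix.det (Matrix.of fun i j => fiberInner p (z i) (b j)) := by
  rw [berezin, ExteriorAlgebra.liftAlternating_apply_ιMulti, Pi.single_eq_same]
  rfl

lemma berezin_eq_zero_of_mem {j : ℕ} (hj : j ≠ q) {s : ExteriorAlgebra ℝ (Z q)}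
    (hs : s ∈ ⋀[ℝ]^j (Z q)) : berezin p b s = 0 := by
  rw [← ExteriorAlgebra.ιMulti_span_fixedDegree] at hs
  induction hs using Submodule.span_induction with
  | mem s hs =>
    obtain ⟨z, rfl⟩ := hs
    rw [berezin, ExteriorAlgebra.liftAlternating_apply_ιMulti, Pi.single_eq_of_ne hj,
      AlternatingMap.zero_apply]
  | zero => exact map_zero _
  | add x y _ _ hx hy => rw [map_add, hx, hy, add_zero]
  | smul c x _ hx => rw [map_smul, hx, smul_zero]

lemma berezin_map (N : Z q →ₗ[ℝ] Z q) (s : ExteriorAlgebra ℝ (Z q)) :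
    berezin p b (ExteriorAlgebra.map N s) = LinearMap.det N * berezin p b s := by
  suffices h : berezin p b ∘ₗ (ExteriorAlgebra.map N).toLinearMap =
      LinearMap.det N • berezin p b from LinearMap.congr_fun h s
  refine ExteriorAlgebra.lhom_ext fun i => ?_
  ext z
  change berezin p b (ExteriorAlgebra.map N (ExteriorAlgebra.ιMulti ℝ i z)) =
    LinearMap.det N • berezin p b (ExteriorAlgebra.ιMulti ℝ i z)
  by_cases hi : i = q
  · subst hi
    let f : Z i [⋀^Fin i]→ₗ[ℝ] ℝ :=
      (berezin p b).compAlternatingMap (ExteriorAlgebra.ιMulti ℝ i)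
    rw [ExteriorAlgebra.map_apply_ιMulti]
    change f (N ∘ z) = LinearMap.det N • f z
    rw [f.eq_smul_basis_det (Pi.basisFun ℝ (Fin i)), AlternatingMap.smul_apply,
      AlternatingMap.smul_apply, Module.Basis.det_comp, smul_eq_mul, smul_eq_mul, smul_eq_mul,
      mul_left_comm]
  · have hz := ExteriorAlgebra.ιMulti_range ℝ i ⟨z, rfl⟩
    rw [berezin_eq_zero_of_mem p b hi hz,
      berezin_eq_zero_of_mem p b hi (map_mem_exteriorPower N hz), smul_zero]

lemma berezinForm_biTmul (ω : Forms T) (s : ExteriorAlgebra ℝ (Z q)) :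
    berezinForm p b (biTmul ω s) = berezin p b s • ω := rfl

lemma berezinForm_biMap (L : T →ₗ[ℝ] T') (N : Z q →ₗ[ℝ] Z q) (x : BiForms T' q) :
    berezinForm p b (biMap L N x) = LinearMap.det N • pullbackLin L (berezinForm p b x) := by
  induction x using BiForms.induction with
  | zero => simp only [map_zero, smul_zero]
  | tmul ω s =>
    rw [biMap_biTmul, berezinForm_biTmul, berezinForm_biTmul, berezin_map, map_smul, smul_smul]
  | add x y hx hy => simp only [map_add, hx, hy, smul_add]

/-- The sums of elements of bidegree `(k, k)`, `k ≥ 0`, whose form part is a product of linear forms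
in `M`. -/
def diagSpan (q : ℕ) (M : Submodule ℝ (Module.Dual ℝ T)) : Submodule ℝ (BiForms T q) :=
  Submodule.span ℝ {x | ∃ k : ℕ, ∃ ω ∈ (M.map (ExteriorAlgebra.ι ℝ)) ^ k, ∃ s ∈ ⋀[ℝ]^k (Z q),
    x = biTmul ω s}

lemma map_ι_pow_le_exteriorPower (M : Submodule ℝ (Module.Dual ℝ T)) (k : ℕ) :
    (M.map (ExteriorAlgebra.ι ℝ)) ^ k ≤ ⋀[ℝ]^k (Module.Dual ℝ T) :=
  pow_le_pow_left' LinearMap.map_le_range k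

lemma mul_mem_diagSpan {M : Submodule ℝ (Module.Dual ℝ T)} {x y : BiForms T q}
    (hx : x ∈ diagSpan q M) (hy : y ∈ diagSpan q M) : x * y ∈ diagSpan q M := by
  suffices h : diagSpan q M * diagSpan q M ≤ diagSpan q M from h (Submodule.mul_mem_mul hx hy)
  rw [diagSpan, Submodule.span_mul_span, Submodule.span_le]
  rintro _ ⟨_, ⟨j, ω, hω, s, hs, rfl⟩, _, ⟨k, η, hη, t, ht, rfl⟩, rfl⟩
  change biTmul ω s * biTmul η t ∈ diagSpan q M
  rw [biTmul_mul_biTmul ω hs (map_ι_pow_le_exteriorPower M k hη) t]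
  refine Submodule.smul_mem _ _ (Submodule.subset_span
    ⟨j + k, _, ?_, _, SetLike.mul_mem_graded hs ht, rfl⟩)
  rw [pow_add]
  exact Submodule.mul_mem_mul hω hη

lemma mem_diagSpan_of_mem_genAlg {M : Submodule ℝ (Module.Dual ℝ T)} {x : BiForms T q}
    (hx : x ∈ genAlg q M) : x ∈ diagSpan q M := by
  induction hx using Algebra.adjoin_induction with
  | mem x hx =>
    obtain ⟨a, ha, z, rfl⟩ := hx
    exact Submodule.subset_span ⟨1, _, by rw [pow_one]; exact ⟨a, ha, rfl⟩, _,
      ι_mem_exteriorPower_one z, rfl⟩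
  | algebraMap r =>
    rw [Algebra.algebraMap_eq_smul_one]
    exact Submodule.smul_mem _ _ (Submodule.subset_span
      ⟨0, 1, by rw [pow_zero]; exact Submodule.one_le.1 le_rfl, 1, SetLike.one_mem_graded _,
        biTmul_one_one.symm⟩)
  | add x y _ _ hx hy => exact add_mem hx hy
  | mul x y _ _ hx hy => exact mul_mem_diagSpan hx hy

lemma berezinForm_mem_map_ι_pow {M : Submodule ℝ (Module.Dual ℝ T)} {x : BiForms T q}
    (hx : x ∈ genAlg q M) : berezinForm p b x ∈ (M.map (ExteriorAlgebra.ι ℝ)) ^ q := by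
  have mem_diagSpan := mem_diagSpan_of_mem_genAlg hx
  clear hx
  induction mem_diagSpan using Submodule.span_induction with
  | mem x hx =>
    obtain ⟨k, ω, hω, s, hs, rfl⟩ := hx
    rw [berezinForm_biTmul]
    by_cases hk : k = q
    · exact Submodule.smul_mem _ _ (hk ▸ hω)
    · rw [berezin_eq_zero_of_mem p b hk hs, zero_smul]
      exact zero_mem _
  | zero =>
    rw [map_zero]
    exact zero_mem _
  | add x y _ _ hx hy =>
    rw [map_add]
    exact add_mem hx hy
  | smul c x _ hx =>
    rw [map_smul]
    exact Submodule.smul_mem _ _ hx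

end Berezin

/-! ## Smooth functions with values in a vector space -/

section Smooth

variable {P W A B C : Type} [NormedAddCommGroup W] [NormedSpace ℝ W] [AddCommGroup A] [Module ℝ A]
  [AddCommGroup B] [Module ℝ B] [AddCommGroup C] [Module ℝ C] {emb : P → W}

/-- The finite sums `∑ cᵢ aᵢ` with `aᵢ ∈ A` and with coefficients `cᵢ` that are restrictions of
smooth functions to `P`, embedded in `W` by `emb`. -/
def smoothMaps (emb : P → W) (A : Type) [AddCommGroup A] [Module ℝ A] : Submodule ℝ (P → A) :=
  Submodule.span ℝ {f | ∃ (c : W → ℝ) (a : A), ContDiff ℝ ((⊤ : ℕ∞) : WithTop ℕ∞) c ∧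
    f = fun x => c (emb x) • a}

lemma smul_mem_smoothMaps {c : W → ℝ} (hc : ContDiff ℝ ((⊤ : ℕ∞) : WithTop ℕ∞) c) (a : A) :
    (fun x => c (emb x) • a) ∈ smoothMaps emb A :=
  Submodule.subset_span ⟨c, a, hc, rfl⟩

lemma const_mem_smoothMaps (a : A) : (fun _ => a) ∈ smoothMaps emb A := by
  simpa using smul_mem_smoothMaps (emb := emb) (c := fun _ => 1) contDiff_const a

lemma linearMap_mem_smoothMaps [FiniteDimensional ℝ W] (L : W →ₗ[ℝ] A) :
    (fun x => L (emb x)) ∈ smoothMaps emb A := by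
  let basis := Module.finBasis ℝ W
  have expand : (fun x => L (emb x)) = ∑ i, fun x => basis.coord i (emb x) • L (basis i) := by
    ext x
    conv_lhs => rw [← basis.sum_repr (emb x), map_sum]
    simp only [map_smul, Finset.sum_apply, Module.Basis.coord_apply]
  rw [expand]
  exact sum_mem fun i _ =>
    smul_mem_smoothMaps (LinearMap.toContinuousLinearMap (basis.coord i)).contDiff _

lemma isSmooth_of_mem_smoothMaps {f : P → A} (hf : f ∈ smoothMaps emb A) : IsSmooth emb f := by
  intro ℓ
  induction hf using Submodule.span_induction with
  | mem f hf =>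
    obtain ⟨c, a, hc, rfl⟩ := hf
    exact ⟨fun y => c y * ℓ a, hc.mul contDiff_const, fun x => by rw [map_smul, smul_eq_mul]⟩
  | zero => exact ⟨0, contDiff_const, fun _ => (map_zero ℓ).symm⟩
  | add f g _ _ hf hg =>
    obtain ⟨F, hF, F_emb⟩ := hf
    obtain ⟨G, hG, G_emb⟩ := hg
    exact ⟨F + G, hF.add hG, fun x => by
      rw [Pi.add_apply, Pi.add_apply, map_add, F_emb, G_emb]⟩
  | smul r f _ hf =>
    obtain ⟨F, hF, F_emb⟩ := hf
    exact ⟨r • F, contDiff_const.smul hF, fun x => by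
      rw [Pi.smul_apply, Pi.smul_apply, map_smul, F_emb]⟩

lemma mem_smoothMaps_of_isSmooth [FiniteDimensional ℝ A] {f : P → A} (hf : IsSmooth emb f) :
    f ∈ smoothMaps emb A := by
  let basis := Module.finBasis ℝ A
  choose F hF F_emb using fun i => hf (basis.coord i)
  have expand : f = ∑ i, fun x => F i (emb x) • basis i := by
    ext x
    simp only [Finset.sum_apply, F_emb, Module.Basis.coord_apply, basis.sum_repr]
  rw [expand]
  exact sum_mem fun i _ => smul_mem_smoothMaps (hF i) _

lemma map_mem_smoothMaps (L : A →ₗ[ℝ] B) {f : P → A} (hf : f ∈ smoothMaps emb A) :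
    (fun x => L (f x)) ∈ smoothMaps emb B := by
  suffices h : smoothMaps emb A ≤ (smoothMaps emb B).comap (L.compLeft P) from h hf
  refine Submodule.span_le.2 ?_
  rintro _ ⟨c, a, hc, rfl⟩
  simpa [LinearMap.compLeft, Function.comp_def] using smul_mem_smoothMaps hc (L a)

lemma map₂_mem_smoothMaps (L : A →ₗ[ℝ] B →ₗ[ℝ] C) {f : P → A} {g : P → B}
    (hf : f ∈ smoothMaps emb A) (hg : g ∈ smoothMaps emb B) :
    (fun x => L (f x) (g x)) ∈ smoothMaps emb C := by
  induction hf, hg using Submodule.span_induction₂ with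
  | mem_mem f g hf hg =>
    obtain ⟨c, a, hc, rfl⟩ := hf
    obtain ⟨d, b, hd, rfl⟩ := hg
    simpa [smul_smul] using smul_mem_smoothMaps (hd.mul hc) (L a b)
  | zero_left g _ =>
    simp only [Pi.zero_apply, map_zero, LinearMap.zero_apply]
    exact zero_mem _
  | zero_right f _ =>
    simp only [Pi.zero_apply, map_zero]
    exact zero_mem _
  | add_left f f' g _ _ _ hf hf' =>
    simp only [Pi.add_apply, map_add, LinearMap.add_apply]
    exact add_mem hf hf'
  | add_right f g g' _ _ _ hg hg' =>
    simp only [Pi.add_apply, map_add]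
    exact add_mem hg hg'
  | smul_left r f g _ _ h =>
    simp only [Pi.smul_apply, map_smul, LinearMap.smul_apply]
    exact Submodule.smul_mem _ r h
  | smul_right r f g _ _ h =>
    simp only [Pi.smul_apply, map_smul]
    exact Submodule.smul_mem _ r h

lemma fun_smul_mem_smoothMaps {c : W → ℝ} (hc : ContDiff ℝ ((⊤ : ℕ∞) : WithTop ℕ∞) c) {f : P → A}
    (hf : f ∈ smoothMaps emb A) : (fun x => c (emb x) • f x) ∈ smoothMaps emb A := by
  simpa using map₂_mem_smoothMaps (LinearMap.lsmul ℝ A) (smul_mem_smoothMaps hc (1 : ℝ)) hf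

lemma comp_mem_smoothMaps {P' W' : Type} [NormedAddCommGroup W'] [NormedSpace ℝ W']
    {emb' : P' → W'} {φ : P → P'} {Φ : W → W'} (hΦ : ContDiff ℝ ((⊤ : ℕ∞) : WithTop ℕ∞) Φ)
    (emb_φ : ∀ x, emb' (φ x) = Φ (emb x)) {f : P' → A} (hf : f ∈ smoothMaps emb' A) :
    (fun x => f (φ x)) ∈ smoothMaps emb A := by
  suffices h : smoothMaps emb' A ≤ (smoothMaps emb A).comap (LinearMap.funLeft ℝ A φ) from h hf
  refine Submodule.span_le.2 ?_
  rintro _ ⟨c, a, hc, rfl⟩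
  simpa [LinearMap.funLeft, Function.comp_def, emb_φ] using smul_mem_smoothMaps (hc.comp hΦ) a

variable {R : Type} [Ring R] [Algebra ℝ R]

lemma mul_mem_smoothMaps {f g : P → R} (hf : f ∈ smoothMaps emb R) (hg : g ∈ smoothMaps emb R) :
    (fun x => f x * g x) ∈ smoothMaps emb R :=
  map₂_mem_smoothMaps (LinearMap.mul ℝ R) hf hg

lemma pow_mem_smoothMaps {f : P → R} (hf : f ∈ smoothMaps emb R) (n : ℕ) :
    (fun x => f x ^ n) ∈ smoothMaps emb R := by
  induction n with
  | zero => simpa using const_mem_smoothMaps (emb := emb) (1 : R)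
  | succ n ih => simpa only [pow_succ] using mul_mem_smoothMaps ih hf

lemma algExp_mem_smoothMaps {f : P → R} (hf : f ∈ smoothMaps emb R) {N : ℕ}
    (hN : ∀ x, f x ^ N = 0) : (fun x => algExp (f x)) ∈ smoothMaps emb R := by
  have expand : (fun x => algExp (f x)) =
      ∑ i ∈ Finset.range N, (i.factorial : ℝ)⁻¹ • fun x => f x ^ i := by
    ext x
    simp only [algExp_eq_sum_of_pow_eq_zero (hN x), Finset.sum_apply, Pi.smul_apply]
  rw [expand]
  exact sum_mem fun i _ => Submodule.smul_mem _ _ (pow_mem_smoothMaps hf i)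

lemma pullbackLin_mem_smoothMaps {T T' : Type} [AddCommGroup T] [Module ℝ T] [AddCommGroup T']
    [Module ℝ T'] {L : P → T →ₗ[ℝ] T'} (hL : L ∈ smoothMaps emb (T →ₗ[ℝ] T'))
    {ω : P → Forms T'} (hω : ω ∈ smoothMaps emb (Forms T')) :
    (fun x => pullbackLin (L x) (ω x)) ∈ smoothMaps emb (Forms T) := by
  have of_const : ∀ η : Forms T', (fun x => pullbackLin (L x) η) ∈ smoothMaps emb (Forms T) := by
    intro η
    induction η using ExteriorAlgebra.induction with
    | algebraMap r => simpa using const_mem_smoothMaps (algebraMap ℝ (Forms T) r)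
    | ι a =>
      simp only [pullbackLin_ι]
      exact map_mem_smoothMaps (ExteriorAlgebra.ι ℝ ∘ₗ LinearMap.llcomp ℝ T T' ℝ a) hL
    | mul η η' h h' =>
      simp only [map_mul]
      exact mul_mem_smoothMaps h h'
    | add η η' h h' =>
      simp only [map_add]
      exact add_mem h h'
  induction hω using Submodule.span_induction with
  | mem ω hω =>
    obtain ⟨c, η, hc, rfl⟩ := hω
    simp only [map_smul]
    exact fun_smul_mem_smoothMaps hc (of_const η)
  | zero =>
    simp only [Pi.zero_apply, map_zero]
    exact zero_mem _
  | add ω ω' _ _ h h' =>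
    simp only [Pi.add_apply, map_add]
    exact add_mem h h'
  | smul r ω _ h =>
    simp only [Pi.smul_apply, map_smul]
    exact Submodule.smul_mem _ r h

lemma finiteDimensional_forms (T : Type) [AddCommGroup T] [Module ℝ T] [FiniteDimensional ℝ T] :
    FiniteDimensional ℝ (Forms T) :=
  Module.Finite.of_basis (Module.finBasis ℝ (Module.Dual ℝ T)).ExteriorAlgebra

end Smooth

/-! ## Exponents of the form `F - ½ ∑ Lᵢ²` -/

section QuadraticExponent

variable {T T' : Type} [AddCommGroup T] [Module ℝ T] [AddCommGroup T'] [Module ℝ T'] {q r : ℕ}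
  {ι : Type} [Fintype ι]

lemma vectorForm_sq (L : T →ₗ[ℝ] Z q) :
    vectorForm L ^ 2 = (-2 : ℝ) • ∑ μ : Fin q, ∑ ν ∈ Finset.Ioi μ,
      biTmul (ExteriorAlgebra.ι ℝ (LinearMap.proj μ ∘ₗ L) *
        ExteriorAlgebra.ι ℝ (LinearMap.proj ν ∘ₗ L)) (eVec μ * eVec ν) := by
  let x : Fin q → BiForms T q := fun μ => gen (LinearMap.proj μ ∘ₗ L) (Pi.single μ 1 : Z q)
  have off_diagonal : ∀ ν, ∑ μ, x μ * x ν = ∑ μ ∈ {ν}ᶜ, x μ * x ν := fun ν => by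
    rw [← Finset.sum_add_sum_compl {ν}, Finset.sum_singleton, gen_mul_gen_self_right, zero_add]
  have add_swap : ∀ μ ν, x ν * x μ + x μ * x ν =
      (-2 : ℝ) • biTmul (ExteriorAlgebra.ι ℝ (LinearMap.proj μ ∘ₗ L) *
        ExteriorAlgebra.ι ℝ (LinearMap.proj ν ∘ₗ L)) (eVec μ * eVec ν) := fun μ ν => by
    rw [(gen_commute _ _ _ _).eq, gen_mul_gen, ← two_smul ℝ, smul_neg, neg_smul]
    rfl
  calc vectorForm L ^ 2
      = ∑ ν, ∑ μ ∈ {ν}ᶜ, x μ * x ν := by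
        rw [pow_two, vectorForm_eq_sum_gen, Finset.sum_mul_sum, Finset.sum_comm,
          Finset.sum_congr rfl fun ν _ => off_diagonal ν]
    _ = ∑ μ, ∑ ν ∈ Finset.Ioi μ, (x ν * x μ + x μ * x ν) :=
        (Finset.sum_sum_Ioi_add_eq_sum_sum_off_diag fun μ ν => x μ * x ν).symm
    _ = _ := by simp only [add_swap, Finset.smul_sum]

lemma sum_vectorForm_sq_isNilpotent (c : ℝ) (L : ι → T →ₗ[ℝ] Z q) :
    IsNilpotent (c • ∑ i, vectorForm (L i) ^ 2) := by
  refine IsNilpotent.smul (Commute.isNilpotent_sum (fun i _ => ?_) fun i j _ _ => ?_) c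
  · exact IsNilpotent.pow_of_pos ⟨q + 1, vectorForm_pow_eq_zero _⟩ two_ne_zero
  · exact (vectorForm_commute _ _).pow_pow 2 2

lemma vectorForm_commute_sum_sq (F : T →ₗ[ℝ] Z q) (c : ℝ) (L : ι → T →ₗ[ℝ] Z q) :
    Commute (vectorForm F) (c • ∑ i, vectorForm (L i) ^ 2) :=
  Commute.smul_right (Commute.sum_right _ _ _ fun _ _ => (vectorForm_commute _ _).pow_right 2) c

lemma sum_vectorForm_sq_of_mul_transpose_eq_one [DecidableEq ι] {U : Matrix ι ι ℝ}
    (hU : U * U.transpose = 1) (L : ι → T →ₗ[ℝ] Z q) :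
    ∑ α, vectorForm (∑ β, U β α • L β) ^ 2 = ∑ β, vectorForm (L β) ^ 2 := by
  have orthonormal : ∀ β γ, ∑ α, U β α * U γ α = if β = γ then 1 else 0 := fun β γ => by
    simpa [Matrix.mul_apply, Matrix.one_apply] using congrFun (congrFun hU β) γ
  calc ∑ α, vectorForm (∑ β, U β α • L β) ^ 2
      = ∑ α, ∑ β, ∑ γ, (U β α * U γ α) • (vectorForm (L β) * vectorForm (L γ)) := by
        simp only [← vectorFormₗ_apply, map_sum, map_smul, pow_two, Finset.sum_mul_sum,
          smul_mul_smul_comm]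
    _ = ∑ β, ∑ γ, (∑ α, U β α * U γ α) • (vectorForm (L β) * vectorForm (L γ)) := by
        rw [Finset.sum_comm]
        refine Finset.sum_congr rfl fun β _ => ?_
        rw [Finset.sum_comm]
        simp only [Finset.sum_smul]
    _ = ∑ β, vectorForm (L β) ^ 2 := by
        simp only [orthonormal, ite_smul, one_smul, zero_smul, Finset.sum_ite_eq, Finset.mem_univ,
          if_true, pow_two]

/-- The exponent `F - ½ ∑ Lᵢ²` attached to `z₀`-valued `1`-forms `F` and `Lᵢ`. The exponents of the
Mathai–Quillen form and of its pullback have this form, `F` being a covariant derivative and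
`-½ ∑ Lᵢ²` the curvature. -/
def quadraticExponent (F : T →ₗ[ℝ] Z q) (L : ι → T →ₗ[ℝ] Z q) : BiForms T q :=
  vectorForm F + (-(1 / 2) : ℝ) • ∑ i, vectorForm (L i) ^ 2

lemma quadraticExponent_isNilpotent (F : T →ₗ[ℝ] Z q) (L : ι → T →ₗ[ℝ] Z q) :
    IsNilpotent (quadraticExponent F L) :=
  (vectorForm_commute_sum_sq F _ L).isNilpotent_add ⟨q + 1, vectorForm_pow_eq_zero F⟩
    (sum_vectorForm_sq_isNilpotent _ L)

lemma algExp_quadraticExponent (F : T →ₗ[ℝ] Z q) (L : ι → T →ₗ[ℝ] Z q) :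
    algExp (quadraticExponent F L) =
      algExp (vectorForm F) * algExp ((-(1 / 2) : ℝ) • ∑ i, vectorForm (L i) ^ 2) :=
  algExp_add_of_commute (vectorForm_commute_sum_sq F _ L) ⟨q + 1, vectorForm_pow_eq_zero F⟩
    (sum_vectorForm_sq_isNilpotent _ L)

lemma quadraticExponent_mem_genAlg {M : Submodule ℝ (Module.Dual ℝ T)} {F : T →ₗ[ℝ] Z q}
    (hF : ∀ μ, LinearMap.proj μ ∘ₗ F ∈ M) {L : ι → T →ₗ[ℝ] Z q}
    (hL : ∀ i μ, LinearMap.proj μ ∘ₗ L i ∈ M) : quadraticExponent F L ∈ genAlg q M :=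
  add_mem (vectorForm_mem_genAlg hF) (Subalgebra.smul_mem _
    (sum_mem fun i _ => pow_mem (vectorForm_mem_genAlg (hL i)) 2) _)

lemma berezinForm_algExp_quadraticExponent_mem (p : ℕ) (b : Fin q → Z q)
    {M : Submodule ℝ (Module.Dual ℝ T)} {F : T →ₗ[ℝ] Z q} (hF : ∀ μ, LinearMap.proj μ ∘ₗ F ∈ M)
    {L : ι → T →ₗ[ℝ] Z q} (hL : ∀ i μ, LinearMap.proj μ ∘ₗ L i ∈ M) :
    berezinForm p b (algExp (quadraticExponent F L)) ∈ (M.map (ExteriorAlgebra.ι ℝ)) ^ q :=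
  berezinForm_mem_map_ι_pow p b (algExp_mem (quadraticExponent_isNilpotent F L)
    (quadraticExponent_mem_genAlg hF hL))

lemma biMap_quadraticExponent (S : T →ₗ[ℝ] T') (N : Z q →ₗ[ℝ] Z r) (F : T' →ₗ[ℝ] Z q)
    (L : ι → T' →ₗ[ℝ] Z q) : biMap S N (quadraticExponent F L) =
      quadraticExponent (N ∘ₗ F ∘ₗ S) (fun i => N ∘ₗ L i ∘ₗ S) := by
  simp only [quadraticExponent, map_add, map_smul, map_sum, map_pow, biMap_vectorForm]

lemma det_smul_pullbackLin_berezinForm_algExp_quadraticExponent (p : ℕ) (b : Fin q → Z q)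
    (S : T →ₗ[ℝ] T') (N : Z q →ₗ[ℝ] Z q) (F : T' →ₗ[ℝ] Z q) (L : ι → T' →ₗ[ℝ] Z q) :
    LinearMap.det N • pullbackLin S (berezinForm p b (algExp (quadraticExponent F L))) =
      berezinForm p b (algExp (quadraticExponent (N ∘ₗ F ∘ₗ S) fun i => N ∘ₗ L i ∘ₗ S)) := by
  rw [← berezinForm_biMap, map_algExp _ (quadraticExponent_isNilpotent F L),
    biMap_quadraticExponent]

lemma algExp_quadraticExponent_mem_smoothMaps {P W : Type} [NormedAddCommGroup W]
    [NormedSpace ℝ W] {emb : P → W} {F : P → T →ₗ[ℝ] Z q}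
    (hF : F ∈ smoothMaps emb (T →ₗ[ℝ] Z q)) (L : ι → T →ₗ[ℝ] Z q) :
    (fun x => algExp (quadraticExponent (F x) L)) ∈ smoothMaps emb (BiForms T q) := by
  simp only [algExp_quadraticExponent]
  exact mul_mem_smoothMaps (algExp_mem_smoothMaps (map_mem_smoothMaps (vectorFormₗ T q) hF)
    fun x => vectorForm_pow_eq_zero (F x)) (const_mem_smoothMaps _)

end QuadraticExponent

/-! ## The orthogonal group and its Lie algebra -/

section Group

variable {p q : ℕ}

lemma act_apply (g : Gplus p q) (v : V p q) : act g v = (mat g).mulVec v := rfl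

lemma pr_incl (w : Z q) : pr p q (incl p q w) = w := rfl

lemma incl_injective : Function.Injective (incl p q) := fun w w' h => by
  rw [← pr_incl (p := p) w, h, pr_incl]

lemma rho_apply (g : Gplus p q) (w : Z q) : rho g w = pr p q (act g (incl p q w)) := rfl

lemma rho_pr (k : Gplus p q) (hk : k ∈ K p q) (u : V p q) :
    rho k (pr p q u) = pr p q (act k u) := by
  rw [rho_apply, act_incl_pr k hk, pr_incl]

lemma incl_rho (k : Gplus p q) (hk : k ∈ K p q) (w : Z q) :
    incl p q (rho k w) = act k (incl p q w) := by
  rw [rho_apply, ← act_incl_pr k hk, pr_incl]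

lemma rho_rho_inv (k : Gplus p q) (hk : k ∈ K p q) (w : Z q) : rho k (rho k⁻¹ w) = w := by
  rw [rho_apply, incl_rho _ (inv_mem hk), act_act_inv, pr_incl]

lemma fiberInner_rho (k : Gplus p q) (hk : k ∈ K p q) (w w' : Z q) :
    fiberInner p (rho k w) (rho k w') = fiberInner p w w' := by
  rw [fiberInner, incl_rho k hk, incl_rho k hk, form_act, fiberInner]

/-- The linear map `A ↦ pr(A u)` on `𝔤`, depending linearly on `u`. -/
def prAct (p q : ℕ) : V p q →ₗ[ℝ] LieG p q →ₗ[ℝ] Z q :=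
  LinearMap.mk₂ ℝ (fun u X => pr p q (X.1.mulVec u))
    (fun u u' X => by simp [Matrix.mulVec_add])
    (fun c u X => by simp [Matrix.mulVec_smul])
    (fun u X Y => by simp [Matrix.add_mulVec])
    (fun c u X => by simp [Matrix.smul_mulVec])

lemma prAct_apply (u : V p q) (A : LieG p q) : prAct p q u A = pr p q (A.1.mulVec u) := rfl

lemma rhoLie_apply (A : LieG p q) (w : Z q) : rhoLie p q A w = prAct p q (incl p q w) A := rfl

/-- The positive basis vector `e_α`. -/
def ePos (p q : ℕ) (α : Fin p) : V p q := Pi.single (Sum.inl α) 1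

/-- The component of `u` orthogonal to `z₀`. -/
def posPart (p q : ℕ) : V p q →ₗ[ℝ] V p q := LinearMap.id - incl p q ∘ₗ pr p q

lemma posPart_apply (u : V p q) : posPart p q u = u - incl p q (pr p q u) := rfl

lemma posPart_eq_sum (u : V p q) : posPart p q u = ∑ α, u (Sum.inl α) • ePos p q α := by
  ext (i | i)
  · simp [posPart_apply, incl, ePos, Finset.sum_apply, Pi.single_apply]
  · simp [posPart_apply, incl, ePos, pr, Finset.sum_apply]

lemma posPart_ePos (α : Fin p) : posPart p q (ePos p q α) = ePos p q α := by
  ext (i | i) <;> simp [posPart_apply, incl, ePos, pr]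

lemma act_posPart (k : Gplus p q) (hk : k ∈ K p q) (u : V p q) :
    act k (posPart p q u) = posPart p q (act k u) := by
  rw [posPart_apply, map_sub, act_incl_pr k hk, posPart_apply]

lemma LieG_apply_inr_inl (A : LieG p q) (μ : Fin q) (α : Fin p) :
    A.1 (Sum.inr μ) (Sum.inl α) = A.1 (Sum.inl α) (Sum.inr μ) := by
  have h := congrFun (congrFun ((mem_LieG_iff A.1).1 A.2) (Sum.inl α)) (Sum.inr μ)
  simpa [gram] using h

lemma prAct_ePos (α : Fin p) (A : LieG p q) (μ : Fin q) :
    prAct p q (ePos p q α) A μ = A.1 (Sum.inl α) (Sum.inr μ) := by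
  rw [← LieG_apply_inr_inl]
  simp [prAct_apply, pr, ePos]

lemma omega_apply (α : Fin p) (μ : Fin q) (A : LieG p q) :
    omega α μ A = A.1 (Sum.inl α) (Sum.inr μ) := rfl

lemma proj_comp_prAct_ePos (α : Fin p) (μ : Fin q) :
    LinearMap.proj μ ∘ₗ prAct p q (ePos p q α) = omega α μ :=
  LinearMap.ext fun A => prAct_ePos α A μ

lemma prAct_incl_projK (w : Z q) (A : LieG p q) :
    prAct p q (incl p q w) (projK p q A) = prAct p q (incl p q w) A := by
  ext μ
  simp [prAct_apply, pr, incl, projK, Matrix.mulVec, dotProduct, Matrix.toBlocks₂₂]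

lemma prAct_posPart_of_mem_LieK (u : V p q) {X : LieG p q} (hX : X ∈ LieK p q) :
    prAct p q (posPart p q u) X = 0 := by
  obtain ⟨A, rfl⟩ := hX
  ext μ
  simp [prAct_apply, posPart_apply, pr, incl, projK, Matrix.mulVec, dotProduct]

lemma Ad_mulVec (g : Gplus p q) (A : LieG p q) (u : V p q) :
    (Ad g A).1.mulVec u = act g (A.1.mulVec (act g⁻¹ u)) := by
  change (mat g * A.1 * mat g⁻¹).mulVec u = _
  rw [← Matrix.mulVec_mulVec, ← Matrix.mulVec_mulVec]
  rfl

lemma rho_prAct_Ad (k : Gplus p q) (hk : k ∈ K p q) (u : V p q) (A : LieG p q) :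
    rho k (prAct p q u (Ad k⁻¹ A)) = prAct p q (act k u) A := by
  rw [prAct_apply, Ad_mulVec, rho_pr k hk, act_act_inv, inv_inv, prAct_apply]

lemma transpose_mat_mul_gram_mul (g : Gplus p q) :
    (mat g).transpose * gram p q * mat g = gram p q := by
  ext i j
  have h := form_act g (Pi.single i 1) (Pi.single j 1)
  rw [form_eq_dotProduct, form_eq_dotProduct, act_apply, act_apply, Matrix.mulVec_mulVec,
    Matrix.dotProduct_mulVec, Matrix.vecMul_mulVec, ← Matrix.dotProduct_mulVec] at h
  simpa [mul_assoc] using h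

lemma mat_mul_mat_inv (g : Gplus p q) : mat g * mat g⁻¹ = 1 := by
  rw [← mat_mul, mul_inv_cancel, mat_one]

lemma mat_inv (g : Gplus p q) : mat g⁻¹ = gram p q * (mat g).transpose * gram p q := by
  calc mat g⁻¹ = gram p q * (gram p q) * mat g⁻¹ := by rw [gram_mul_gram, one_mul]
    _ = gram p q * ((mat g).transpose * gram p q * mat g) * mat g⁻¹ := by
      rw [transpose_mat_mul_gram_mul]
    _ = gram p q * (mat g).transpose * gram p q * (mat g * mat g⁻¹) := by simp only [mul_assoc]
    _ = _ := by rw [mat_mul_mat_inv, mul_one]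

lemma mat_mul_gram_mul_transpose (g : Gplus p q) :
    mat g * gram p q * (mat g).transpose = gram p q :=
  calc mat g * gram p q * (mat g).transpose
      = mat g * (gram p q * (mat g).transpose * gram p q) * gram p q := by
        simp only [mul_assoc, gram_mul_gram, mul_one]
    _ = gram p q := by rw [← mat_inv, mat_mul_mat_inv, one_mul]

lemma incl_single (μ : Fin q) : incl p q (Pi.single μ 1) = Pi.single (Sum.inr μ) 1 := by
  ext (i | i) <;> simp [incl, Pi.single_apply]

lemma mat_inl_inr (k : Gplus p q) (hk : k ∈ K p q) (α : Fin p) (μ : Fin q) :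
    mat k (Sum.inl α) (Sum.inr μ) = 0 := by
  have act_single_inl := congrFun (incl_rho k hk (Pi.single μ 1)) (Sum.inl α)
  rw [incl_single] at act_single_inl
  simpa [incl, act_apply] using act_single_inl.symm

lemma toBlocks₁₁_mul_transpose (k : Gplus p q) (hk : k ∈ K p q) :
    (mat k).toBlocks₁₁ * (mat k).toBlocks₁₁.transpose = 1 := by
  ext β γ
  have entry := congrFun (congrFun (mat_mul_gram_mul_transpose k) (Sum.inl β)) (Sum.inl γ)
  simpa [gram, Matrix.mul_apply, Matrix.mul_diagonal, Fintype.sum_sum_type, mat_inl_inr k hk,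
    Matrix.diagonal_apply, Matrix.toBlocks₁₁, Matrix.one_apply] using entry

lemma act_ePos (k : Gplus p q) (hk : k ∈ K p q) (α : Fin p) :
    act k (ePos p q α) = ∑ β, (mat k).toBlocks₁₁ β α • ePos p q β := by
  conv_lhs => rw [← posPart_ePos, act_posPart k hk, posPart_eq_sum]
  simp [act_apply, ePos, Matrix.toBlocks₁₁]

lemma pr_mulVec_incl (A : Matrix (Fin p ⊕ Fin q) (Fin p ⊕ Fin q) ℝ) (w : Z q) :
    pr p q (A.mulVec (incl p q w)) = A.toBlocks₂₂.mulVec w := by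
  ext μ
  simp [pr, incl, Matrix.mulVec, dotProduct, Matrix.toBlocks₂₂]

lemma form_eq_sum_of_pr_eq_zero {u : V p q} (hu : pr p q u = 0) :
    form u u = ∑ α, u (Sum.inl α) ^ 2 := by
  have inr_eq_zero : ∀ μ, u (Sum.inr μ) = 0 := congrFun hu
  simp [form, inr_eq_zero, pow_two]

-- A kernel vector `w` of the block would give `Q(gw, gw) ≥ 0`, although `Q(w, w) < 0`.
lemma det_toBlocks₂₂_ne_zero (g : orthogonalGroup p q) : g.1.1.toBlocks₂₂.det ≠ 0 := by
  intro det_eq_zero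
  obtain ⟨w, w_ne_zero, block_w⟩ := Matrix.exists_mulVec_eq_zero_iff.2 det_eq_zero
  rw [← pr_mulVec_incl] at block_w
  have form_nonneg : 0 ≤ form (incl p q w) (incl p q w) := by
    rw [← g.2, form_eq_sum_of_pr_eq_zero block_w]
    exact Finset.sum_nonneg fun _ _ => sq_nonneg _
  have inner_self : fiberInner p w w = w ⬝ᵥ w := fiberInner_eq_sum p w w
  have dotProduct_nonpos : w ⬝ᵥ w ≤ 0 := by
    rw [← inner_self, fiberInner]
    exact neg_nonpos.2 form_nonneg
  exact w_ne_zero (dotProduct_self_eq_zero.1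
    (dotProduct_nonpos.antisymm (Finset.sum_nonneg fun μ _ => mul_self_nonneg (w μ))))

lemma det_toBlocks₂₂_pos (g : Gplus p q) : 0 < (mat g).toBlocks₂₂.det := by
  set blockDet : orthogonalGroup p q → ℝ := fun g => g.1.1.toBlocks₂₂.det with blockDet_def
  have continuous_blockDet : Continuous blockDet :=
    Continuous.matrix_det <| continuous_matrix fun i j =>
      (Units.continuous_val.comp continuous_subtype_val).matrix_elem _ _
  have blockDet_one : blockDet 1 = 1 := by
    have toBlocks₂₂_one : (1 : Matrix (Fin p ⊕ Fin q) (Fin p ⊕ Fin q) ℝ).toBlocks₂₂ = 1 := by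
      ext i j; simp [Matrix.toBlocks₂₂, Matrix.one_apply]
    simp [blockDet_def, toBlocks₂₂_one]
  have image_preconnected :=
    (isPreconnected_connectedComponent (x := (1 : orthogonalGroup p q))).image _
      continuous_blockDet.continuousOn
  by_contra not_pos
  obtain ⟨x, -, hx⟩ := image_preconnected.Icc_subset ⟨g.1, g.2, rfl⟩
    ⟨1, mem_connectedComponent, rfl⟩ ⟨not_lt.1 not_pos, blockDet_one ▸ zero_le_one⟩
  exact det_toBlocks₂₂_ne_zero x hx

lemma rho_eq_toLin' (g : Gplus p q) : rho g = Matrix.toLin' (mat g).toBlocks₂₂ :=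
  LinearMap.ext fun w => pr_mulVec_incl (mat g) w

lemma transpose_mul_toBlocks₂₂ (k : Gplus p q) (hk : k ∈ K p q) :
    (mat k).toBlocks₂₂.transpose * (mat k).toBlocks₂₂ = 1 := by
  ext μ ν
  have entry := fiberInner_rho k hk (Pi.single μ 1) (Pi.single ν 1)
  simpa [fiberInner_eq_sum, rho_eq_toLin', Matrix.mul_apply, Matrix.one_apply,
    Pi.single_apply, eq_comm] using entry

lemma det_rho (k : Gplus p q) (hk : k ∈ K p q) : LinearMap.det (rho k) = 1 := by
  have det_sq := congrArg Matrix.det (transpose_mul_toBlocks₂₂ k hk)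
  rw [Matrix.det_mul, Matrix.det_transpose, Matrix.det_one] at det_sq
  rw [rho_eq_toLin', LinearMap.det_toLin']
  nlinarith [det_toBlocks₂₂_pos k]

/-! ## Covariant derivative of the tautological section and curvature -/

lemma differential_eq {P T : Type} [AddCommGroup T] [Module ℝ T] (curve : P → T → ℝ → P)
    (f : P → Z q) (x : P) (L : T →ₗ[ℝ] Z q)
    (h : ∀ ξ : T, HasDerivAt (fun t : ℝ => f (curve x ξ t)) (L ξ) 0) :
    differential curve f x = L := by
  have exists_differential :
      ∃ L : T →ₗ[ℝ] Z q, ∀ ξ : T, HasDerivAt (fun t : ℝ => f (curve x ξ t)) (L ξ) 0 := ⟨L, h⟩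
  rw [differential, dif_pos exists_differential]
  exact LinearMap.ext fun ξ => (exists_differential.choose_spec ξ).unique (h ξ)

/-- The linear map `(A, w) ↦ pr(A u)` on the tangent space `𝔤 × z₀` of `G(ℝ)⁺ × z₀`, depending
linearly on `u`. -/
def prActFst (p q : ℕ) : V p q →ₗ[ℝ] LieG p q × Z q →ₗ[ℝ] Z q :=
  LinearMap.lcomp ℝ (Z q) (LinearMap.fst ℝ (LieG p q) (Z q)) ∘ₗ prAct p q

lemma covariantDerivative_tautological (x : Gplus p q × Z q) :
    covariantDerivative tautological x =
      LinearMap.snd ℝ (LieG p q) (Z q) + prActFst p q (incl p q x.2) := by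
  have differential_tautological :
      differential curveE tautological x = LinearMap.snd ℝ (LieG p q) (Z q) := by
    refine differential_eq _ _ _ _ fun ξ => ?_
    change HasDerivAt (fun t : ℝ => x.2 + t • ξ.2) ξ.2 0
    simpa using ((hasDerivAt_id (0 : ℝ)).smul_const ξ.2).const_add x.2
  rw [covariantDerivative, differential_tautological]
  exact congrArg _ (LinearMap.ext fun ξ => prAct_incl_projK x.2 ξ.1)

lemma fiberInner_rhoLie_single (A : LieG p q) (μ ν : Fin q) :
    fiberInner p (rhoLie p q A (Pi.single μ 1)) (Pi.single ν 1) =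
      A.1 (Sum.inr ν) (Sum.inr μ) := by
  rw [fiberInner_eq_sum, rhoLie_apply, prAct_apply, incl_single]
  simp [pr, Pi.single_apply]

-- The curvature is minus the `𝔨`-component of the bracket of the `𝔭`-components.
lemma curvature_inr_inr (ξ η : LieG p q × Z q) (μ ν : Fin q) :
    (curvature ξ η).1 (Sum.inr ν) (Sum.inr μ) =
      ∑ α, (omega α μ ξ.1 * omega α ν η.1 - omega α ν ξ.1 * omega α μ η.1) := by
  simp only [curvature, bracket, connection, projK, omega_apply, LinearMap.comp_apply,
    LinearMap.fst_apply, LinearMap.coe_mk, AddHom.coe_mk, Submodule.coe_sub, Matrix.sub_apply,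
    Matrix.mul_apply, Fintype.sum_sum_type, Matrix.fromBlocks_apply₂₂, Matrix.fromBlocks_apply₂₁,
    Matrix.fromBlocks_apply₁₂, Matrix.toBlocks₂₂, Matrix.of_apply, Matrix.zero_apply, zero_mul,
    Finset.sum_const_zero, zero_add, LieG_apply_inr_inl, Finset.sum_sub_distrib]
  rw [Finset.sum_congr rfl fun α _ => mul_comm (η.1.1 (Sum.inl α) (Sum.inr ν)) _]
  ring

lemma twoForm_curvature (μ ν : Fin q) :
    (twoForm fun ξ η : LieG p q × Z q =>
      fiberInner p (rhoLie p q (curvature ξ η) (Pi.single μ 1)) (Pi.single ν 1)) =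
      ∑ α, ExteriorAlgebra.ι ℝ (LinearMap.proj μ ∘ₗ prActFst p q (ePos p q α)) *
        ExteriorAlgebra.ι ℝ (LinearMap.proj ν ∘ₗ prActFst p q (ePos p q α)) := by
  simp only [fiberInner_rhoLie_single, curvature_inr_inr, prActFst, ← LinearMap.comp_assoc,
    LinearMap.comp_apply, LinearMap.lcomp_apply', proj_comp_prAct_ePos, twoForm_sum,
    ← twoForm_mul_sub_mul]
  rfl

lemma curvatureForm_eq (p q : ℕ) : curvatureForm p q =
    (-(1 / 2) : ℝ) • ∑ α, vectorForm (prActFst p q (ePos p q α)) ^ 2 := by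
  have half_mul_two : (-(1 / 2) : ℝ) * -2 = 1 := by norm_num
  simp only [curvatureForm, twoForm_curvature, vectorForm_sq, ← Finset.smul_sum, smul_smul,
    half_mul_two, one_smul]
  rw [Finset.sum_comm]
  refine Finset.sum_congr rfl fun μ _ => ?_
  rw [Finset.sum_comm]
  refine Finset.sum_congr rfl fun ν _ => ?_
  simp only [← biTmulₗ_apply, map_sum, LinearMap.sum_apply]

end Group

/-! ## The Mathai–Quillen form -/

section MathaiQuillen

variable {p q : ℕ}

/-- The constant `(-1)^{q(q+1)/2} (2π)^{-q/2}` in front of the Berezin integral. -/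
def mqConst (q : ℕ) : ℝ := (-1 : ℝ) ^ (q * (q + 1) / 2) * (2 * Real.pi) ^ (-(q : ℝ) / 2)

/-- The `1`-form `-2√π ∇̃𝐬` at the points `(g, w)`, on which it depends only through `w`. -/
def mqLinearPart (p q : ℕ) (w : Z q) : LieG p q × Z q →ₗ[ℝ] Z q :=
  -(2 * √Real.pi) • (LinearMap.snd ℝ (LieG p q) (Z q) + prActFst p q (incl p q w))

/-- The nilpotent part `-2√π ∇̃𝐬 + ρ(R̃)` of the Mathai–Quillen exponent at the points `(g, w)`. -/
def mqExponent (p q : ℕ) (w : Z q) : BiForms (LieG p q × Z q) q :=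
  quadraticExponent (mqLinearPart p q w) fun α => prActFst p q (ePos p q α)

lemma mathaiQuillen_eq (b : Fin q → Z q) (g : Gplus p q) (w : Z q) :
    mathaiQuillen p q b (g, w) =
      (mqConst q * Real.exp (-(2 * Real.pi * fiberInner p w w))) •
        berezinForm p b (algExp (mqExponent p q w)) := by
  have nilpotent_part : -((2 * √Real.pi) •
      vectorForm (covariantDerivative tautological (g, w))) + curvatureForm p q =
        mqExponent p q w := by
    rw [curvatureForm_eq, covariantDerivative_tautological, mqExponent, quadraticExponent,
      mqLinearPart, ← vectorFormₗ_apply, ← vectorFormₗ_apply, map_smul, neg_smul (2 * √Real.pi)]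
  rw [mathaiQuillen, sub_eq_add_neg, add_assoc, nilpotent_part, mqExponent,
    algExp_smul_one_add _ (quadraticExponent_isNilpotent _ _), map_smul, smul_smul]
  rfl

lemma mqLinearPart_apply_vertical (w : Z q) (X : LieG p q) :
    mqLinearPart p q w (X, -rhoLie p q X w) = 0 := by
  change -(2 * √Real.pi) • (-rhoLie p q X w + rhoLie p q X w) = 0
  rw [neg_add_cancel, smul_zero]

lemma prActFst_ePos_apply_vertical (α : Fin p) (w : Z q) {X : LieG p q} (hX : X ∈ LieK p q) :
    prActFst p q (ePos p q α) (X, w) = 0 := by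
  rw [← posPart_ePos]
  exact prAct_posPart_of_mem_LieK _ hX

lemma rho_comp_prActFst_comp (k : Gplus p q) (hk : k ∈ K p q) (u : V p q) :
    rho k ∘ₗ prActFst p q u ∘ₗ LinearMap.prodMap (Ad k⁻¹) (rho k⁻¹) =
      prActFst p q (act k u) :=
  LinearMap.ext fun _ => rho_prAct_Ad k hk _ _

lemma rho_comp_mqLinearPart_comp (k : Gplus p q) (hk : k ∈ K p q) (w : Z q) :
    rho k ∘ₗ mqLinearPart p q (rho k⁻¹ w) ∘ₗ LinearMap.prodMap (Ad k⁻¹) (rho k⁻¹) =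
      mqLinearPart p q w := by
  have snd_part : rho k ∘ₗ LinearMap.snd ℝ (LieG p q) (Z q) ∘ₗ
      LinearMap.prodMap (Ad k⁻¹) (rho k⁻¹) = LinearMap.snd ℝ (LieG p q) (Z q) :=
    LinearMap.ext fun ξ => rho_rho_inv k hk ξ.2
  rw [mqLinearPart, LinearMap.smul_comp, LinearMap.comp_smul, LinearMap.add_comp,
    LinearMap.comp_add, snd_part, rho_comp_prActFst_comp k hk, incl_rho _ (inv_mem hk),
    act_act_inv, mqLinearPart]

lemma quadraticExponent_prActFst_act (k : Gplus p q) (hk : k ∈ K p q)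
    (F : LieG p q × Z q →ₗ[ℝ] Z q) :
    (quadraticExponent F fun α => prActFst p q (act k (ePos p q α))) =
      quadraticExponent F fun α => prActFst p q (ePos p q α) := by
  have prActFst_act : ∀ α, prActFst p q (act k (ePos p q α)) =
      ∑ β, (mat k).toBlocks₁₁ β α • prActFst p q (ePos p q β) := fun α => by
    simp only [act_ePos k hk, map_sum, map_smul]
  simp only [quadraticExponent, prActFst_act,
    sum_vectorForm_sq_of_mul_transpose_eq_one (toBlocks₁₁_mul_transpose k hk)]

lemma pullbackLin_berezinForm_algExp_mqExponent (b : Fin q → Z q) (k : Gplus p q) (hk : k ∈ K p q)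
    (w : Z q) :
    pullbackLin (LinearMap.prodMap (Ad k⁻¹) (rho k⁻¹))
        (berezinForm p b (algExp (mqExponent p q (rho k⁻¹ w)))) =
      berezinForm p b (algExp (mqExponent p q w)) := by
  rw [← one_smul ℝ (pullbackLin _ _), ← det_rho k hk, mqExponent,
    det_smul_pullbackLin_berezinForm_algExp_quadraticExponent, rho_comp_mqLinearPart_comp k hk]
  simp only [rho_comp_prActFst_comp k hk, quadraticExponent_prActFst_act k hk]
  rfl

lemma mqLinearPart_mem_smoothMaps (p q : ℕ) :
    (fun x : Gplus p q × Z q => mqLinearPart p q x.2) ∈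
      smoothMaps (fun x : Gplus p q × Z q => (entries x.1, x.2)) _ :=
  Submodule.smul_mem _ (-(2 * √Real.pi)) (add_mem (const_mem_smoothMaps _)
    (linearMap_mem_smoothMaps (prActFst p q ∘ₗ incl p q ∘ₗ
      LinearMap.snd ℝ (Fin p ⊕ Fin q → Fin p ⊕ Fin q → ℝ) (Z q))))

lemma mathaiQuillen_mem_smoothMaps (b : Fin q → Z q) :
    mathaiQuillen p q b ∈ smoothMaps (fun x : Gplus p q × Z q => (entries x.1, x.2)) _ := by
  have smooth_scalar : ContDiff ℝ ((⊤ : ℕ∞) : WithTop ℕ∞)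
      fun y : (Fin p ⊕ Fin q → Fin p ⊕ Fin q → ℝ) × Z q =>
        mqConst q * Real.exp (-(2 * Real.pi * fiberInner p y.2 y.2)) := by
    simp only [fiberInner_eq_sum]
    fun_prop
  rw [show mathaiQuillen p q b = fun x => _ from funext fun x => mathaiQuillen_eq b x.1 x.2]
  exact fun_smul_mem_smoothMaps smooth_scalar (map_mem_smoothMaps (berezinForm p b)
    (algExp_quadraticExponent_mem_smoothMaps (mqLinearPart_mem_smoothMaps p q) _))

theorem isFormOnE_mathaiQuillen (b : Fin q → Z q) (Δ : Subgroup (Gplus p q)) :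
    IsFormOnE Δ q (mathaiQuillen p q b) where
  degree x := by
    rw [mathaiQuillen_eq]
    exact Submodule.smul_mem _ _ (map_ι_pow_le_exteriorPower ⊤ q
      (berezinForm_algExp_quadraticExponent_mem p b (fun _ => Submodule.mem_top)
        fun _ _ => Submodule.mem_top))
  smooth := isSmooth_of_mem_smoothMaps (mathaiQuillen_mem_smoothMaps b)
  horizontal g w X hX := by
    have mem_annihilator := berezinForm_algExp_quadraticExponent_mem p b
      (M := LinearMap.ker (Module.Dual.eval ℝ _ (X, -rhoLie p q X w)))
      (F := mqLinearPart p q w) (fun μ => congrFun (mqLinearPart_apply_vertical w X) μ)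
      (L := fun α => prActFst p q (ePos p q α))
      fun α μ => congrFun (prActFst_ePos_apply_vertical α _ hX) μ
    rw [mathaiQuillen_eq, map_smul, mqExponent,
      interior_eq_zero_of_mem_map_ι_pow (fun _ ha => ha) mem_annihilator, smul_zero]
  invariant g w k hk := by
    rw [mathaiQuillen_eq, mathaiQuillen_eq, map_smul, fiberInner_rho _ (inv_mem hk),
      pullbackLin_berezinForm_algExp_mqExponent b k hk]
  leftInvariant δ _ g w := by rw [mathaiQuillen_eq, mathaiQuillen_eq]

end MathaiQuillen

/-! ## Pullback of forms on `E` by the sections `s_v` -/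

section Pullback

variable {p q : ℕ}

lemma E.mk_injective (g : Gplus p q) : Function.Injective fun w : Z q => E.mk g w := by
  intro w w' mk_eq
  obtain ⟨k, -, g_eq, act_eq⟩ := Quotient.exact mk_eq
  have k_eq_one : k = 1 := by simpa using g_eq
  rw [k_eq_one, act_one] at act_eq
  exact (incl_injective act_eq).symm

lemma sectionMap_sectionV (v : V p q) (g : Gplus p q) :
    sectionMap (sectionV v) g = pr p q (act g⁻¹ v) :=
  Function.leftInverse_invFun (E.mk_injective g) _

lemma act_curveG_inv (v : V p q) (g : Gplus p q) (A : LieG p q) (t : ℝ) :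
    act (curveG g A t)⁻¹ v = (NormedSpace.exp (t • -A.1)).mulVec (act g⁻¹ v) := by
  rw [curveG, mul_inv_rev, act_mul, smul_neg]
  rfl

open scoped Matrix.Norms.Operator in
lemma hasDerivAt_exp_smul_mulVec (A : Matrix (Fin p ⊕ Fin q) (Fin p ⊕ Fin q) ℝ) (u : V p q) :
    HasDerivAt (fun t : ℝ => (NormedSpace.exp (t • A)).mulVec u) (A.mulVec u) 0 := by
  have hasDerivAt_exp : HasDerivAt (fun t : ℝ => NormedSpace.exp (t • A)) A 0 := by
    have hasDerivAt_smul := hasDerivAt_exp_smul_const (𝕂 := ℝ) A 0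
    rw [zero_smul, NormedSpace.exp_zero, one_mul] at hasDerivAt_smul
    exact hasDerivAt_smul
  exact (LinearMap.toContinuousLinearMap
    ((Matrix.mulVecBilin ℝ ℝ).flip u)).hasFDerivAt.comp_hasDerivAt 0 hasDerivAt_exp

lemma differential_sectionV (v : V p q) (g : Gplus p q) :
    differential curveG (sectionMap (sectionV v)) g = -prAct p q (act g⁻¹ v) := by
  refine differential_eq _ _ _ _ fun A => ?_
  have hasDerivAt_pr := (LinearMap.toContinuousLinearMap (pr p q)).hasFDerivAt.comp_hasDerivAt 0
    (hasDerivAt_exp_smul_mulVec (-A.1) (act g⁻¹ v))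
  have derivative_eq : pr p q ((-A.1).mulVec (act g⁻¹ v)) = (-prAct p q (act g⁻¹ v)) A := by
    rw [LinearMap.neg_apply, prAct_apply, Matrix.neg_mulVec, map_neg]
  simp only [sectionMap_sectionV, act_curveG_inv]
  rw [← derivative_eq]
  exact hasDerivAt_pr

/-- The differential of the map `g ↦ (g, pr(g⁻¹ v))` covering `s_v`, at a point with `g⁻¹ v = u`. -/
def liftDifferential (u : V p q) : LieG p q →ₗ[ℝ] LieG p q × Z q :=
  LinearMap.prod LinearMap.id (-prAct p q u)

lemma pullbackSection_sectionV (v : V p q) (α : Gplus p q × Z q → Forms (LieG p q × Z q))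
    (g : Gplus p q) : pullbackSection (sectionV v) α g =
      pullbackLin (liftDifferential (act g⁻¹ v)) (α (g, pr p q (act g⁻¹ v))) := by
  rw [pullbackSection, sectionMap_sectionV, differential_sectionV, liftDifferential]

lemma liftDifferential_apply_of_mem_LieK (u : V p q) {X : LieG p q} (hX : X ∈ LieK p q) :
    liftDifferential u X = (X, -rhoLie p q X (pr p q u)) := by
  have prAct_eq := prAct_posPart_of_mem_LieK u hX
  rw [posPart_apply, map_sub, LinearMap.sub_apply, sub_eq_zero] at prAct_eq
  rw [rhoLie_apply, ← prAct_eq]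
  rfl

lemma liftDifferential_comp_Ad (u : V p q) (k : Gplus p q) (hk : k ∈ K p q) :
    liftDifferential (act k⁻¹ u) ∘ₗ Ad k⁻¹ =
      LinearMap.prodMap (Ad k⁻¹) (rho k⁻¹) ∘ₗ liftDifferential u := by
  refine LinearMap.ext fun A => Prod.ext rfl ?_
  change -prAct p q (act k⁻¹ u) (Ad k⁻¹ A) = rho k⁻¹ (-prAct p q u A)
  rw [map_neg, prAct_apply, Ad_mulVec, inv_inv, act_act_inv, prAct_apply, rho_pr _ (inv_mem hk)]

/-- The action of `g⁻¹` on `v`, as a linear function of the entries of `g`. -/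
def actInv (v : V p q) : (Fin p ⊕ Fin q → Fin p ⊕ Fin q → ℝ) →ₗ[ℝ] V p q where
  toFun m := (gram p q * (Matrix.of m).transpose * gram p q).mulVec v
  map_add' m n := by
    rw [← Matrix.add_mulVec, ← add_mul, ← mul_add]
    rfl
  map_smul' c m := by
    rw [RingHom.id_apply, ← Matrix.smul_mulVec, ← smul_mul_assoc, ← mul_smul_comm]
    rfl

lemma actInv_entries (v : V p q) (g : Gplus p q) : actInv v (entries g) = act g⁻¹ v := by
  rw [act_apply, mat_inv]
  rfl

lemma liftDifferential_mem_smoothMaps (v : V p q) :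
    (fun g : Gplus p q => liftDifferential (act g⁻¹ v)) ∈ smoothMaps entries _ := by
  let inrₗ : (LieG p q →ₗ[ℝ] Z q) →ₗ[ℝ] LieG p q →ₗ[ℝ] LieG p q × Z q :=
    LinearMap.llcomp ℝ _ _ _ (LinearMap.inr ℝ (LieG p q) (Z q))
  have affine : (fun g : Gplus p q => liftDifferential (act g⁻¹ v)) =
      (fun _ => LinearMap.inl ℝ (LieG p q) (Z q)) +
        fun g => (inrₗ ∘ₗ (-prAct p q) ∘ₗ actInv v) (entries g) := by
    refine funext fun g => LinearMap.ext fun A => ?_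
    simp [liftDifferential, inrₗ, actInv_entries]
  rw [affine]
  exact add_mem (const_mem_smoothMaps _) (linearMap_mem_smoothMaps _)

lemma pullbackSection_mem_smoothMaps (v : V p q) {α : Gplus p q × Z q → Forms (LieG p q × Z q)}
    (hα : α ∈ smoothMaps (fun x : Gplus p q × Z q => (entries x.1, x.2)) _) :
    pullbackSection (sectionV v) α ∈ smoothMaps entries _ := by
  have α_comp_mem : (fun g : Gplus p q => α (g, pr p q (act g⁻¹ v))) ∈ smoothMaps entries _ := by
    refine comp_mem_smoothMaps (Φ := fun m => (m, pr p q (actInv v m))) ?_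
      (fun g => by rw [actInv_entries]) hα
    exact contDiff_id.prodMk
      (LinearMap.toContinuousLinearMap (pr p q ∘ₗ actInv v)).contDiff
  rw [show pullbackSection (sectionV v) α = fun g => _ from
    funext (pullbackSection_sectionV v α)]
  exact pullbackLin_mem_smoothMaps (liftDifferential_mem_smoothMaps v) α_comp_mem

theorem IsFormOnE.isFormOnD_pullbackSection {Δ : Subgroup (Gplus p q)} {n : ℕ}
    {α : Gplus p q × Z q → Forms (LieG p q × Z q)} (hα : IsFormOnE Δ n α) {v : V p q}
    (hv : ∀ δ ∈ Δ, act δ v = v) : IsFormOnD Δ n (pullbackSection (sectionV v) α) where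
  degree g := pullbackLin_mem_exteriorPower _ (hα.degree _)
  smooth := by
    have := finiteDimensional_forms (LieG p q × Z q)
    exact isSmooth_of_mem_smoothMaps
      (pullbackSection_mem_smoothMaps v (mem_smoothMaps_of_isSmooth hα.smooth))
  horizontal g X hX := by
    rw [pullbackSection_sectionV, interior_pullbackLin,
      liftDifferential_apply_of_mem_LieK _ hX, hα.horizontal g _ X hX, map_zero]
  invariant g k hk := by
    rw [pullbackSection_sectionV, pullbackSection_sectionV, mul_inv_rev, act_mul,
      pullbackLin_pullbackLin, liftDifferential_comp_Ad _ k hk, ← pullbackLin_pullbackLin,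
      ← rho_pr _ (inv_mem hk), hα.invariant g _ k hk]
  leftInvariant δ hδ g := by
    rw [pullbackSection_sectionV, pullbackSection_sectionV, mul_inv_rev, act_mul, hv _ (inv_mem hδ),
      hα.leftInvariant δ hδ]

lemma IsFormOnD.const_smul {Δ : Subgroup (Gplus p q)} {n : ℕ} {α : Gplus p q → Forms (LieG p q)}
    (h : IsFormOnD Δ n α) (c : ℝ) : IsFormOnD Δ n (c • α) where
  degree g := Submodule.smul_mem _ _ (h.degree g)
  smooth ℓ := by
    obtain ⟨F, contDiff_F, F_entries⟩ := h.smooth (c • ℓ)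
    exact ⟨F, contDiff_F, fun x => by rw [F_entries]; simp⟩
  horizontal g X hX := by rw [Pi.smul_apply, map_smul, h.horizontal g X hX, smul_zero]
  invariant g k hk := by rw [Pi.smul_apply, map_smul, h.invariant g k hk, Pi.smul_apply]
  leftInvariant δ hδ g := by rw [Pi.smul_apply, h.leftInvariant δ hδ g, Pi.smul_apply]

/-- The nilpotent part of the exponent of `s_v^* U_MQ` at a point `g` with `g⁻¹ v = u`. -/
def pullbackExponent (u : V p q) : BiForms (LieG p q) q :=
  quadraticExponent ((2 * √Real.pi) • prAct p q (posPart p q u)) fun α => prAct p q (ePos p q α)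

lemma mqLinearPart_comp_liftDifferential (u : V p q) :
    mqLinearPart p q (pr p q u) ∘ₗ liftDifferential u =
      (2 * √Real.pi) • prAct p q (posPart p q u) := by
  refine LinearMap.ext fun A => ?_
  change -(2 * √Real.pi) • (-prAct p q u A + prAct p q (incl p q (pr p q u)) A) = _
  rw [posPart_apply, map_sub, LinearMap.smul_apply, LinearMap.sub_apply]
  module

lemma pullbackSection_mathaiQuillen (b : Fin q → Z q) (v : V p q) (g : Gplus p q) :
    pullbackSection (sectionV v) (mathaiQuillen p q b) g =
      (mqConst q * Real.exp (-(2 * Real.pi *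
        fiberInner p (pr p q (act g⁻¹ v)) (pr p q (act g⁻¹ v))))) •
      berezinForm p b (algExp (pullbackExponent (act g⁻¹ v))) := by
  have pullback_berezin := det_smul_pullbackLin_berezinForm_algExp_quadraticExponent p b
    (liftDifferential (act g⁻¹ v)) LinearMap.id (mqLinearPart p q (pr p q (act g⁻¹ v)))
    fun α => prActFst p q (ePos p q α)
  rw [LinearMap.det_id, one_smul, LinearMap.id_comp, mqLinearPart_comp_liftDifferential]
    at pullback_berezin
  rw [pullbackSection_sectionV, mathaiQuillen_eq, map_smul, mqExponent, pullback_berezin]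
  rfl

end Pullback

/-! ## Creation operators on vector-valued Schwartz functions -/

section EvalTensor

variable {p q : ℕ} {M N : Type} [AddCommGroup M] [Module ℝ M] [AddCommGroup N] [Module ℝ N]

/-- Evaluation at `u` of a Schwartz function with values in `M`, the latter being encoded as an
element of `M ⊗ 𝓢(V)`. -/
def evalTensor (M : Type) [AddCommGroup M] [Module ℝ M] (u : V p q) :
    M ⊗[ℝ] 𝓢(V p q, ℝ) →ₗ[ℝ] M :=
  (TensorProduct.rid ℝ M).toLinearMap ∘ₗ LinearMap.lTensor M
    ({ toFun := fun f => f u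
       map_add' := fun _ _ => rfl
       map_smul' := fun _ _ => rfl } : 𝓢(V p q, ℝ) →ₗ[ℝ] ℝ)

lemma evalTensor_tmul (u : V p q) (m : M) (f : 𝓢(V p q, ℝ)) :
    evalTensor M u (m ⊗ₜ f) = f u • m := rfl

lemma evalTensor_map (u : V p q) (L : M →ₗ[ℝ] N) (D : 𝓢(V p q, ℝ) →ₗ[ℝ] 𝓢(V p q, ℝ))
    (Y : M ⊗[ℝ] 𝓢(V p q, ℝ)) :
    evalTensor N u (TensorProduct.map L D Y) = L (evalTensor M u (LinearMap.lTensor M D Y)) := by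
  induction Y using TensorProduct.induction_on with
  | zero => simp
  | tmul m f => rw [TensorProduct.map_tmul, LinearMap.lTensor_tmul, evalTensor_tmul,
      evalTensor_tmul, map_smul]
  | add x y hx hy => simp only [map_add, hx, hy]

lemma creation_apply (α : Fin p) (f : 𝓢(V p q, ℝ)) (u : V p q) :
    creation α f u = u (Sum.inl α) * f u - 1 / (2 * Real.pi) * fderiv ℝ f u (ePos p q α) := by
  have temperate : Function.HasTemperateGrowth (fun v : V p q => v (Sum.inl α)) :=
    (ContinuousLinearMap.proj (R := ℝ) (φ := fun _ : Fin p ⊕ Fin q => ℝ)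
      (Sum.inl α)).hasTemperateGrowth
  rw [← SchwartzMap.lineDerivOp_apply_eq_fderiv]
  simp [creation, temperate, ePos]

lemma hasDerivAt_evalTensor (α : Fin p) (u : V p q) (Y : M ⊗[ℝ] 𝓢(V p q, ℝ))
    (ℓ : Module.Dual ℝ M) :
    HasDerivAt (fun t : ℝ => ℓ (evalTensor M (u + t • ePos p q α) Y))
      (2 * Real.pi * (u (Sum.inl α) * ℓ (evalTensor M u Y) -
        ℓ (evalTensor M u (LinearMap.lTensor M (creation α) Y)))) 0 := by
  induction Y using TensorProduct.induction_on with
  | zero => simpa using hasDerivAt_const (0 : ℝ) (0 : ℝ)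
  | tmul m f =>
    simp only [LinearMap.lTensor_tmul, evalTensor_tmul, map_smul, creation_apply, smul_eq_mul]
    have line : HasDerivAt (fun t : ℝ => u + t • ePos p q α) (ePos p q α) 0 := by
      simpa using ((hasDerivAt_id (0 : ℝ)).smul_const (ePos p q α)).const_add u
    have hf : HasFDerivAt f (fderiv ℝ f u) (u + (0 : ℝ) • ePos p q α) := by
      rw [zero_smul, add_zero]; exact f.differentiableAt.hasFDerivAt
    refine ((hf.comp_hasDerivAt (0 : ℝ) line).mul_const (ℓ m)).congr_deriv ?_
    field_simp
    ring
  | add x y hx hy =>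
    simp only [map_add]
    refine (hx.add hy).congr_deriv ?_
    ring

lemma evalTensor_lTensor_creation (α : Fin p) (u : V p q) (Y : M ⊗[ℝ] 𝓢(V p q, ℝ)) (d : M)
    (hd : ∀ ℓ : Module.Dual ℝ M,
      HasDerivAt (fun t : ℝ => ℓ (evalTensor M (u + t • ePos p q α) Y)) (ℓ d) 0) :
    evalTensor M u (LinearMap.lTensor M (creation α) Y) =
      u (Sum.inl α) • evalTensor M u Y - (1 / (2 * Real.pi)) • d := by
  rw [← sub_eq_zero, ← Module.forall_dual_apply_eq_zero_iff ℝ]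
  intro ℓ
  have deriv_eq := (hd ℓ).unique (hasDerivAt_evalTensor α u Y ℓ)
  simp only [map_sub, map_smul, smul_eq_mul, deriv_eq]
  field_simp
  ring

end EvalTensor

/-! ## The generating function of the Howe operator -/

section PartialExponent

variable {p q : ℕ}

/-- The `z₀`-valued `1`-form `ω_{αμ} ⊗ e_μ`. -/
def cell (α : Fin p) (μ : Fin q) : LieG p q →ₗ[ℝ] Z q :=
  LinearMap.single ℝ (fun _ : Fin q => ℝ) μ ∘ₗ omega α μ

lemma vectorForm_cell (α : Fin p) (μ : Fin q) :
    vectorForm (cell α μ) = gen (omega α μ) (Pi.single μ 1 : Z q) := by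
  rw [vectorForm_eq_sum_gen, Finset.sum_eq_single_of_mem μ (Finset.mem_univ _)]
  · congr 2
    ext A
    simp [cell]
  · intro ν _ hν
    have component_zero : LinearMap.proj ν ∘ₗ cell α μ = (0 : Module.Dual ℝ (LieG p q)) := by
      ext A
      simp [cell, hν]
    rw [component_zero, map_zero, LinearMap.zero_apply]

lemma vectorForm_cell_mul_vectorForm_cell (α β : Fin p) (m : Fin q) :
    vectorForm (cell α m) * vectorForm (cell β m) = 0 := by
  rw [vectorForm_cell, vectorForm_cell, gen_mul_gen_self_right]

/-- The `z₀`-valued `1`-form `∑_μ ω_{αμ} ⊗ e_μ`, the sum being over a list of indices `μ`. -/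
def row (l : List (Fin q)) (α : Fin p) : LieG p q →ₗ[ℝ] Z q := (l.map (cell α)).sum

lemma row_cons (m : Fin q) (l : List (Fin q)) (α : Fin p) :
    row (m :: l) α = cell α m + row l α := by
  simp [row]

lemma row_finRange (α : Fin p) : row (List.finRange q) α = prAct p q (ePos p q α) := by
  have row_eq_sum : row (List.finRange q) α = ∑ μ, cell α μ := by
    rw [row, ← List.ofFn_eq_map, List.sum_ofFn]
  rw [row_eq_sum]
  refine LinearMap.ext fun A => funext fun ν => ?_
  rw [prAct_ePos]
  simp [cell, omega_apply, Finset.sum_apply, Pi.single_apply]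

/-- The part of the exponent of `s_v^* U_MQ` that involves only the indices `μ` in a list. -/
def partialExponent (l : List (Fin q)) (u : V p q) : BiForms (LieG p q) q :=
  quadraticExponent ((2 * √Real.pi) • ∑ α, u (Sum.inl α) • row l α) (row l)

lemma partialExponent_nil (u : V p q) : partialExponent [] u = 0 := by
  simp [partialExponent, quadraticExponent, row, ← vectorFormₗ_apply]

lemma partialExponent_finRange (u : V p q) :
    partialExponent (List.finRange q) u = pullbackExponent u := by
  simp only [partialExponent, pullbackExponent, funext row_finRange, row_finRange, posPart_eq_sum,
    map_sum, map_smul]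

lemma partialExponent_isNilpotent (l : List (Fin q)) (u : V p q) :
    IsNilpotent (partialExponent l u) :=
  quadraticExponent_isNilpotent _ _

lemma partialExponent_mem_genAlg (l : List (Fin q)) (u : V p q) :
    partialExponent l u ∈ genAlg q (⊤ : Submodule ℝ (Module.Dual ℝ (LieG p q))) :=
  quadraticExponent_mem_genAlg (fun _ => Submodule.mem_top) fun _ _ => Submodule.mem_top

/-- The increment of `partialExponent` when the index `m` is added to the list `l`. -/
def increment (m : Fin q) (l : List (Fin q)) (u : V p q) : BiForms (LieG p q) q :=
  ∑ α, vectorForm (cell α m) * ((2 * √Real.pi * u (Sum.inl α)) • 1 - vectorForm (row l α))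

lemma increment_mem_genAlg (m : Fin q) (l : List (Fin q)) (u : V p q) :
    increment m l u ∈ genAlg q (⊤ : Submodule ℝ (Module.Dual ℝ (LieG p q))) :=
  sum_mem fun _ _ => mul_mem (vectorForm_mem_genAlg_top _)
    (sub_mem (Subalgebra.smul_mem _ (one_mem _) _) (vectorForm_mem_genAlg_top _))

lemma increment_mul_self (m : Fin q) (l : List (Fin q)) (u : V p q) :
    increment m l u * increment m l u = 0 := by
  rw [increment, Finset.sum_mul_sum]
  refine Finset.sum_eq_zero fun α _ => Finset.sum_eq_zero fun β _ => ?_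
  have commute := commute_of_mem_genAlg (M := ⊤)
    (sub_mem (Subalgebra.smul_mem _ (one_mem _) (2 * √Real.pi * u (Sum.inl α)))
      (vectorForm_mem_genAlg_top (row l α))) (vectorForm_mem_genAlg_top (cell β m))
  rw [mul_assoc, ← mul_assoc _ (vectorForm (cell β m)), commute.eq, ← mul_assoc, ← mul_assoc,
    vectorForm_cell_mul_vectorForm_cell, zero_mul, zero_mul]

lemma vectorForm_row_cons_sq (m : Fin q) (l : List (Fin q)) (α : Fin p) :
    vectorForm (row (m :: l) α) ^ 2 = vectorForm (row l α) ^ 2 +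
      (2 : ℝ) • (vectorForm (cell α m) * vectorForm (row l α)) := by
  rw [row_cons, ← vectorFormₗ_apply, map_add, vectorFormₗ_apply, vectorFormₗ_apply, pow_two,
    add_mul, mul_add, mul_add, vectorForm_cell_mul_vectorForm_cell,
    (vectorForm_commute (row l α) (cell α m)).eq, two_smul, pow_two]
  abel

lemma partialExponent_cons (m : Fin q) (l : List (Fin q)) (u : V p q) :
    partialExponent (m :: l) u = partialExponent l u + increment m l u := by
  simp only [partialExponent, quadraticExponent, increment, vectorForm_row_cons_sq]
  simp only [row_cons, ← vectorFormₗ_apply, map_sum, map_smul, map_add, Finset.sum_add_distrib,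
    smul_add, mul_sub, Finset.sum_sub_distrib, mul_smul_comm, mul_one, Finset.smul_sum, smul_smul]
  norm_num
  abel

lemma algExp_partialExponent_cons (m : Fin q) (l : List (Fin q)) (u : V p q) :
    algExp (partialExponent (m :: l) u) =
      algExp (partialExponent l u) + increment m l u * algExp (partialExponent l u) := by
  have square_zero := increment_mul_self m l u
  have commute := commute_of_mem_genAlg (increment_mem_genAlg m l u)
    (partialExponent_mem_genAlg l u)
  rw [partialExponent_cons, add_comm, algExp_add_of_commute commute
    ⟨2, by rw [pow_two, square_zero]⟩ (partialExponent_isNilpotent l u),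
    algExp_of_mul_self_eq_zero square_zero, add_mul, one_mul]

lemma partialExponent_add_smul_ePos (l : List (Fin q)) (u : V p q) (α : Fin p) (t : ℝ) :
    partialExponent l (u + t • ePos p q α) =
      partialExponent l u + t • ((2 * √Real.pi) • vectorForm (row l α)) := by
  have linear_part : ∑ β, (u + t • ePos p q α) (Sum.inl β) • row l β =
      ∑ β, u (Sum.inl β) • row l β + t • row l α := by
    simp [ePos, add_smul, Finset.sum_add_distrib, Pi.single_apply]
  simp only [partialExponent, quadraticExponent, linear_part, ← vectorFormₗ_apply, map_add,
    map_smul, smul_add]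
  rw [smul_comm t]
  abel

end PartialExponent

section PartialGaussian

variable {p q : ℕ}

lemma siegelMajorant_add_smul_ePos (u : V p q) (α : Fin p) (t : ℝ) :
    siegelMajorant (u + t • ePos p q α) = siegelMajorant u + 2 * t * u (Sum.inl α) + t ^ 2 := by
  have coord_sq : ∀ i, (u + t • ePos p q α) i ^ 2 =
      u i ^ 2 + (ePos p q α i * (2 * t * u (Sum.inl α) + t ^ 2)) := by
    intro i
    by_cases hi : i = Sum.inl α
    · subst hi
      simp only [ePos, Pi.add_apply, Pi.smul_apply, Pi.single_eq_same, smul_eq_mul]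
      ring
    · simp [ePos, hi]
  have sum_ePos : ∑ i, ePos p q α i = 1 := by simp [ePos]
  simp only [siegelMajorant, coord_sq, Finset.sum_add_distrib, ← Finset.sum_mul, sum_ePos]
  ring

lemma gaussian_apply (u : V p q) : gaussian p q u = Real.exp (-Real.pi * siegelMajorant u) := rfl

lemma hasDerivAt_gaussian_add_smul_ePos (u : V p q) (α : Fin p) :
    HasDerivAt (fun t : ℝ => gaussian p q (u + t • ePos p q α))
      (-(2 * Real.pi * u (Sum.inl α)) * gaussian p q u) 0 := by
  simp only [gaussian_apply, siegelMajorant_add_smul_ePos]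
  have majorant : HasDerivAt (fun t : ℝ => siegelMajorant u + 2 * t * u (Sum.inl α) + t ^ 2)
      (2 * u (Sum.inl α)) 0 := by
    refine (((((hasDerivAt_id (0 : ℝ)).const_mul 2).mul_const (u (Sum.inl α))).const_add
      (siegelMajorant u)).add (hasDerivAt_pow 2 (0 : ℝ))).congr_deriv ?_
    simp
  refine ((majorant.const_mul (-Real.pi)).exp).congr_deriv ?_
  simp only [mul_zero, zero_mul, add_zero, ne_eq, OfNat.ofNat_ne_zero, not_false_eq_true, zero_pow]
  ring

/-- The Gaussian times the exponential of `partialExponent`, which interpolates between the Gaussian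
(for the empty list) and the integrand of `s_v^* U_MQ` up to a scalar (for the full list). -/
def partialGaussian (l : List (Fin q)) (u : V p q) : BiForms (LieG p q) q :=
  gaussian p q u • algExp (partialExponent l u)

lemma hasDerivAt_partialGaussian (l : List (Fin q)) (u : V p q) (α : Fin p)
    (ℓ : Module.Dual ℝ (BiForms (LieG p q) q)) :
    HasDerivAt (fun t : ℝ => ℓ (partialGaussian l (u + t • ePos p q α)))
      (ℓ ((-(2 * Real.pi * u (Sum.inl α))) • partialGaussian l u +
        (2 * √Real.pi) • (vectorForm (row l α) * partialGaussian l u))) 0 := by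
  set z : BiForms (LieG p q) q := (2 * √Real.pi) • vectorForm (row l α) with hz
  have z_nilpotent : IsNilpotent z := IsNilpotent.smul ⟨q + 1, vectorForm_pow_eq_zero _⟩ _
  have z_mem : z ∈ genAlg q ⊤ := Subalgebra.smul_mem _ (vectorForm_mem_genAlg_top _) _
  have along_line : ∀ t : ℝ, ℓ (partialGaussian l (u + t • ePos p q α)) =
      gaussian p q (u + t • ePos p q α) * ℓ (algExp (partialExponent l u) * algExp (t • z)) := by
    intro t
    rw [partialGaussian, partialExponent_add_smul_ePos, algExp_add_of_commute _
      (partialExponent_isNilpotent l u) (z_nilpotent.smul t), map_smul, smul_eq_mul]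
    exact commute_of_mem_genAlg (partialExponent_mem_genAlg l u) (Subalgebra.smul_mem _ z_mem t)
  have commute : vectorForm (row l α) * algExp (partialExponent l u) =
      algExp (partialExponent l u) * vectorForm (row l α) :=
    commute_of_mem_genAlg (vectorForm_mem_genAlg_top _)
      (algExp_mem (partialExponent_isNilpotent l u) (partialExponent_mem_genAlg l u))
  have algExp_zero : algExp (0 : BiForms (LieG p q) q) = 1 := by
    rw [algExp_of_mul_self_eq_zero (mul_zero _), add_zero]
  simp_rw [along_line]
  refine ((hasDerivAt_gaussian_add_smul_ePos u α).mul
    (hasDerivAt_apply_mul_algExp_smul (algExp (partialExponent l u)) z_nilpotent ℓ)).congr_deriv ?_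
  simp only [partialGaussian, zero_smul, algExp_zero, mul_one, add_zero, mul_smul_comm, commute,
    map_add, map_smul, smul_eq_mul, hz]
  ring

/-- The operator `∑_α (ω_{αm} ⊗ e_m) ⊗ (x_α - (1/2π) ∂/∂x_α)`. -/
def biHowe (m : Fin q) : Module.End ℝ (BiForms (LieG p q) q ⊗[ℝ] 𝓢(V p q, ℝ)) :=
  ∑ α : Fin p, TensorProduct.map (LinearMap.mulLeft ℝ (vectorForm (cell α m))) (creation α)

/-- The product of the operators `1 + √π biHowe m` over a list, applied to the Gaussian. -/
def expansion : List (Fin q) → BiForms (LieG p q) q ⊗[ℝ] 𝓢(V p q, ℝ)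
  | [] => 1 ⊗ₜ gaussian p q
  | m :: l => expansion l + √Real.pi • biHowe m (expansion l)

/- The operator `√π (x_α - (1/2π) ∂/∂x_α)` multiplies `partialGaussian l` by
`2√π x_α - ∑_{μ ∈ l} ω_{αμ} ⊗ e_μ`, which is the cofactor of `ω_{αm} ⊗ e_m` in `increment m l`. -/
lemma sqrt_pi_smul_evalTensor_biHowe {Y : BiForms (LieG p q) q ⊗[ℝ] 𝓢(V p q, ℝ)}
    {l : List (Fin q)} (hY : ∀ u, evalTensor _ u Y = partialGaussian l u) (m : Fin q)
    (u : V p q) :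
    √Real.pi • evalTensor _ u (biHowe m Y) = increment m l u * partialGaussian l u := by
  have eval_creation : ∀ α, evalTensor _ u (LinearMap.lTensor _ (creation α) Y) =
      u (Sum.inl α) • partialGaussian l u - (1 / (2 * Real.pi)) •
        ((-(2 * Real.pi * u (Sum.inl α))) • partialGaussian l u +
          (2 * √Real.pi) • (vectorForm (row l α) * partialGaussian l u)) := by
    intro α
    rw [evalTensor_lTensor_creation α u Y _ fun ℓ => ?_, hY]
    simpa only [hY] using hasDerivAt_partialGaussian l u α ℓ
  have sqrt_sq : √Real.pi * √Real.pi = Real.pi := Real.mul_self_sqrt Real.pi_pos.le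
  rw [biHowe, LinearMap.sum_apply, map_sum, increment, Finset.sum_mul, Finset.smul_sum]
  refine Finset.sum_congr rfl fun α _ => ?_
  rw [evalTensor_map, eval_creation, LinearMap.mulLeft_apply]
  simp only [mul_assoc, sub_mul, smul_mul_assoc, one_mul, mul_smul_comm, mul_sub, mul_add,
    smul_sub, smul_add, smul_smul]
  match_scalars
  · field_simp
    ring
  · field_simp
    rw [pow_two, sqrt_sq]

lemma evalTensor_expansion (l : List (Fin q)) (u : V p q) :
    evalTensor _ u (expansion l) = partialGaussian l u := by
  induction l generalizing u with
  | nil =>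
    rw [expansion, evalTensor_tmul, partialGaussian, partialExponent_nil,
      algExp_of_mul_self_eq_zero (mul_zero _), add_zero]
  | cons m l ih =>
    rw [expansion, map_add, map_smul, ih, sqrt_pi_smul_evalTensor_biHowe ih, partialGaussian,
      partialGaussian, algExp_partialExponent_cons, smul_add, mul_smul_comm]

end PartialGaussian

/-! ## The part of top degree in `⋀ z₀` -/

section TopDegree

variable {p q : ℕ}

/-- The operator `∑_α ω_{αm} ⊗ (x_α - (1/2π) ∂/∂x_α)`, the factor of the Howe operator with
index `m`. -/
def howeFactor (m : Fin q) : Module.End ℝ (Forms (LieG p q) ⊗[ℝ] 𝓢(V p q, ℝ)) :=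
  ∑ α : Fin p, TensorProduct.map (LinearMap.mulLeft ℝ (ExteriorAlgebra.ι ℝ (omega α m)))
    (creation α)

lemma howe_eq_smul_prod_howeFactor (p q : ℕ) :
    howe p q = (1 / 2 ^ q : ℝ) • ((List.finRange q).map (howeFactor (p := p))).prod := by
  rw [howe, List.ofFn_eq_map]
  rfl

/-- The Schwartz functions with values in the forms of degree `n`. -/
def homogeneousPart (p q n : ℕ) : Submodule ℝ (Forms (LieG p q) ⊗[ℝ] 𝓢(V p q, ℝ)) :=
  Submodule.span ℝ {Y | ∃ ω ∈ ⋀[ℝ]^n (Module.Dual ℝ (LieG p q)), ∃ f, Y = ω ⊗ₜ f}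

/-- The Schwartz functions with values in the forms `ω ⊗ s` with `s` of degree less than `n`. -/
def lowerPart (p q n : ℕ) : Submodule ℝ (BiForms (LieG p q) q ⊗[ℝ] 𝓢(V p q, ℝ)) :=
  Submodule.span ℝ {x | ∃ k, ∃ ω ∈ ⋀[ℝ]^k (Module.Dual ℝ (LieG p q)), ∃ j < n,
    ∃ s ∈ ⋀[ℝ]^j (Z q), ∃ f, x = biTmul ω s ⊗ₜ f}

/-- The map `ω ⊗ f ↦ (ω ⊗ s) ⊗ f`. -/
def insertRight (s : ExteriorAlgebra ℝ (Z q)) :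
    Forms (LieG p q) ⊗[ℝ] 𝓢(V p q, ℝ) →ₗ[ℝ] BiForms (LieG p q) q ⊗[ℝ] 𝓢(V p q, ℝ) :=
  LinearMap.rTensor _ ((biTmulₗ (LieG p q) q).flip s)

lemma insertRight_tmul (s : ExteriorAlgebra ℝ (Z q)) (ω : Forms (LieG p q)) (f : 𝓢(V p q, ℝ)) :
    insertRight s (ω ⊗ₜ f) = biTmul ω s ⊗ₜ f := rfl

lemma evalTensor_insertRight (u : V p q) (s : ExteriorAlgebra ℝ (Z q))
    (Y : Forms (LieG p q) ⊗[ℝ] 𝓢(V p q, ℝ)) :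
    evalTensor _ u (insertRight s Y) = biTmul (evalAt u Y) s :=
  evalTensor_map u _ LinearMap.id Y |>.trans (by rw [LinearMap.lTensor_id]; rfl)

lemma ι_mul_mem_exteriorPower {M : Type} [AddCommGroup M] [Module ℝ M] (m : M) {n : ℕ}
    {x : ExteriorAlgebra ℝ M} (hx : x ∈ ⋀[ℝ]^n M) : ExteriorAlgebra.ι ℝ m * x ∈ ⋀[ℝ]^(n + 1) M := by
  rw [ExteriorAlgebra.exteriorPower, pow_succ']
  exact Submodule.mul_mem_mul ⟨m, rfl⟩ hx

lemma prod_map_eVec_mem_exteriorPower (l : List (Fin q)) :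
    (l.map eVec).prod ∈ ⋀[ℝ]^l.length (Z q) := by
  induction l with
  | nil => exact SetLike.one_mem_graded _
  | cons m l ih =>
    rw [List.map_cons, List.prod_cons]
    exact ι_mul_mem_exteriorPower _ ih

lemma howeFactor_mem_homogeneousPart (m : Fin q) {n : ℕ}
    {Y : Forms (LieG p q) ⊗[ℝ] 𝓢(V p q, ℝ)} (hY : Y ∈ homogeneousPart p q n) :
    howeFactor m Y ∈ homogeneousPart p q (n + 1) := by
  suffices h : homogeneousPart p q n ≤ (homogeneousPart p q (n + 1)).comap (howeFactor m) from h hY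
  refine Submodule.span_le.2 ?_
  rintro _ ⟨ω, hω, f, rfl⟩
  rw [SetLike.mem_coe, Submodule.mem_comap, howeFactor, LinearMap.sum_apply]
  exact sum_mem fun α _ => Submodule.subset_span ⟨_, ι_mul_mem_exteriorPower _ hω, _, rfl⟩

lemma prod_howeFactor_gaussian_mem_homogeneousPart (l : List (Fin q)) :
    (l.map howeFactor).prod (1 ⊗ₜ[ℝ] gaussian p q) ∈ homogeneousPart p q l.length := by
  induction l with
  | nil => exact Submodule.subset_span ⟨1, SetLike.one_mem_graded _, _, rfl⟩
  | cons m l ih =>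
    rw [List.map_cons, List.prod_cons, Module.End.mul_apply]
    exact howeFactor_mem_homogeneousPart m ih

lemma lowerPart_mono : Monotone (lowerPart p q) := fun _ _ h =>
  Submodule.span_mono fun _ ⟨k, ω, hω, j, hj, r⟩ => ⟨k, ω, hω, j, hj.trans_le h, r⟩

lemma insertRight_mem_lowerPart {n j : ℕ} {Y : Forms (LieG p q) ⊗[ℝ] 𝓢(V p q, ℝ)}
    (hY : Y ∈ homogeneousPart p q n) {s : ExteriorAlgebra ℝ (Z q)} (hs : s ∈ ⋀[ℝ]^j (Z q)) :
    insertRight s Y ∈ lowerPart p q (j + 1) := by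
  suffices h : homogeneousPart p q n ≤ (lowerPart p q (j + 1)).comap (insertRight s) from h hY
  refine Submodule.span_le.2 ?_
  rintro _ ⟨ω, hω, f, rfl⟩
  exact Submodule.subset_span ⟨n, ω, hω, j, j.lt_succ_self, s, hs, f, rfl⟩

lemma biHowe_biTmul_tmul (m : Fin q) {k : ℕ} {ω : Forms (LieG p q)}
    (hω : ω ∈ ⋀[ℝ]^k (Module.Dual ℝ (LieG p q))) (s : ExteriorAlgebra ℝ (Z q))
    (f : 𝓢(V p q, ℝ)) :
    biHowe m (biTmul ω s ⊗ₜ[ℝ] f) = (-1 : ℝ) ^ k • ∑ α : Fin p,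
      biTmul (ExteriorAlgebra.ι ℝ (omega α m) * ω) (eVec m * s) ⊗ₜ[ℝ] creation α f := by
  rw [biHowe, LinearMap.sum_apply, Finset.smul_sum]
  refine Finset.sum_congr rfl fun α _ => ?_
  rw [TensorProduct.map_tmul, LinearMap.mulLeft_apply, vectorForm_cell, gen_mul_biTmul _ _ hω,
    TensorProduct.smul_tmul']
  rfl

lemma biHowe_mem_lowerPart (m : Fin q) {n : ℕ} {x : BiForms (LieG p q) q ⊗[ℝ] 𝓢(V p q, ℝ)}
    (hx : x ∈ lowerPart p q n) : biHowe m x ∈ lowerPart p q (n + 1) := by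
  suffices h : lowerPart p q n ≤ (lowerPart p q (n + 1)).comap (biHowe m) from h hx
  refine Submodule.span_le.2 ?_
  rintro _ ⟨k, ω, hω, j, hj, s, hs, f, rfl⟩
  rw [SetLike.mem_coe, Submodule.mem_comap, biHowe_biTmul_tmul m hω]
  exact Submodule.smul_mem _ _ (sum_mem fun α _ => Submodule.subset_span
    ⟨k + 1, _, ι_mul_mem_exteriorPower _ hω, j + 1, by omega, _, ι_mul_mem_exteriorPower _ hs, _,
      rfl⟩)

lemma biHowe_insertRight (m : Fin q) {n : ℕ} {Y : Forms (LieG p q) ⊗[ℝ] 𝓢(V p q, ℝ)}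
    (hY : Y ∈ homogeneousPart p q n) (s : ExteriorAlgebra ℝ (Z q)) :
    biHowe m (insertRight s Y) = (-1 : ℝ) ^ n • insertRight (eVec m * s) (howeFactor m Y) := by
  refine LinearMap.eqOn_span (f := biHowe m ∘ₗ insertRight s)
    (g := (-1 : ℝ) ^ n • (insertRight (eVec m * s) ∘ₗ howeFactor m)) ?_ hY
  rintro _ ⟨ω, hω, f, rfl⟩
  rw [LinearMap.comp_apply, LinearMap.smul_apply, LinearMap.comp_apply, insertRight_tmul,
    biHowe_biTmul_tmul m hω, howeFactor, LinearMap.sum_apply, map_sum]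
  rfl

lemma add_smul_biHowe_sub_smul_insertRight (m : Fin q) {n : ℕ}
    {Y : Forms (LieG p q) ⊗[ℝ] 𝓢(V p q, ℝ)} (hY : Y ∈ homogeneousPart p q n)
    (s : ExteriorAlgebra ℝ (Z q)) (a c : ℝ) (X : BiForms (LieG p q) q ⊗[ℝ] 𝓢(V p q, ℝ)) :
    X + a • biHowe m X - (a * (c * (-1) ^ n)) • insertRight (eVec m * s) (howeFactor m Y) =
      X + a • biHowe m (X - c • insertRight s Y) := by
  rw [map_sub, map_smul, biHowe_insertRight m hY, smul_sub, smul_smul, smul_smul, add_sub_assoc,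
    mul_assoc]

/-- The coefficient of the top degree part of `expansion l` for a list `l` of length `n`: a factor
`√π` for each `1 + √π biHowe m`, and the sign from moving the `e_m` past the `ω_{αm}`. -/
def topCoeff (n : ℕ) : ℝ := √Real.pi ^ n * (-1) ^ n.choose 2

lemma topCoeff_succ (n : ℕ) : topCoeff (n + 1) = √Real.pi * (topCoeff n * (-1) ^ n) := by
  rw [topCoeff, topCoeff, Nat.choose_succ_succ' n 1, Nat.choose_one_right]
  ring

lemma expansion_sub_mem_lowerPart (l : List (Fin q)) :
    expansion l - topCoeff l.length • insertRight (l.map eVec).prod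
      ((l.map howeFactor).prod (1 ⊗ₜ[ℝ] gaussian p q)) ∈ lowerPart p q l.length := by
  induction l with
  | nil =>
    have expansion_nil : expansion ([] : List (Fin q)) = insertRight 1 (1 ⊗ₜ[ℝ] gaussian p q) := rfl
    simp [expansion_nil, topCoeff]
  | cons m l ih =>
    have hY := prod_howeFactor_gaussian_mem_homogeneousPart (p := p) l
    have expansion_mem : expansion l ∈ lowerPart p q (l.length + 1) := by
      rw [← sub_add_cancel (expansion l)]
      exact add_mem (lowerPart_mono (Nat.le_succ _) ih) (Submodule.smul_mem _ _
        (insertRight_mem_lowerPart hY (prod_map_eVec_mem_exteriorPower l)))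
    rw [List.map_cons, List.prod_cons, List.map_cons, List.prod_cons, Module.End.mul_apply,
      List.length_cons, topCoeff_succ, expansion, add_smul_biHowe_sub_smul_insertRight m hY]
    exact add_mem expansion_mem (Submodule.smul_mem _ _ (biHowe_mem_lowerPart m ih))

lemma berezinForm_evalTensor_eq_zero_of_mem_lowerPart (b : Fin q → Z q) (u : V p q)
    {x : BiForms (LieG p q) q ⊗[ℝ] 𝓢(V p q, ℝ)} (hx : x ∈ lowerPart p q q) :
    berezinForm p b (evalTensor _ u x) = 0 := by
  suffices h : lowerPart p q q ≤ LinearMap.ker (berezinForm p b ∘ₗ evalTensor _ u) from h hx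
  refine Submodule.span_le.2 ?_
  rintro _ ⟨k, ω, -, j, hj, s, hs, f, rfl⟩
  rw [SetLike.mem_coe, LinearMap.mem_ker, LinearMap.comp_apply, evalTensor_tmul, map_smul,
    berezinForm_biTmul, berezin_eq_zero_of_mem p b hj.ne hs, zero_smul, smul_zero]

lemma berezin_prod_map_eVec (p : ℕ) (b : Fin q → Z q) :
    berezin p b ((List.finRange q).map eVec).prod = (Matrix.of b).det := by
  have prod_eq : ((List.finRange q).map eVec).prod =
      ExteriorAlgebra.ιMulti ℝ q fun μ => (Pi.single μ 1 : Z q) := by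
    rw [← List.ofFn_eq_map, ExteriorAlgebra.ιMulti_apply]
    rfl
  rw [prod_eq, berezin_ιMulti, ← Matrix.det_transpose]
  congr 1
  ext i j
  simp [fiberInner_eq_sum, Pi.single_apply]

lemma gaussian_smul_berezinForm_algExp_pullbackExponent (b : Fin q → Z q) (u : V p q) :
    gaussian p q u • berezinForm p b (algExp (pullbackExponent u)) =
      (topCoeff q * (Matrix.of b).det * 2 ^ q) • kudlaMillsonBase u := by
  have top_part := berezinForm_evalTensor_eq_zero_of_mem_lowerPart b u (by
    simpa only [List.length_finRange] using expansion_sub_mem_lowerPart (p := p) (List.finRange q))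
  rw [map_sub, map_sub, sub_eq_zero, evalTensor_expansion, partialGaussian, map_smul,
    partialExponent_finRange] at top_part
  rw [top_part, map_smul, map_smul, evalTensor_insertRight, berezinForm_biTmul,
    berezin_prod_map_eVec, kudlaMillsonBase, howe_eq_smul_prod_howeFactor, LinearMap.smul_apply,
    map_smul, smul_smul, smul_smul]
  congr 1
  field_simp

end TopDegree

/-! ## Comparison of the two forms -/

section Comparison

variable {p q : ℕ}

lemma det_mul_self_of_orthonormal (b : Fin q → Z q)
    (hb : ∀ i j, fiberInner p (b i) (b j) = if i = j then 1 else 0) :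
    (Matrix.of b).det * (Matrix.of b).det = 1 := by
  have mul_transpose : Matrix.of b * (Matrix.of b).transpose = 1 := by
    ext i j
    rw [Matrix.one_apply, ← hb, fiberInner_eq_sum, Matrix.mul_apply]
    rfl
  simpa only [Matrix.det_mul, Matrix.det_transpose, Matrix.det_one] using
    congrArg Matrix.det mul_transpose

lemma rpow_neg_natCast_div_two {x : ℝ} (hx : 0 ≤ x) (n : ℕ) :
    x ^ (-(n : ℝ) / 2) = (√x)⁻¹ ^ n := by
  rw [Real.sqrt_eq_rpow, ← Real.rpow_neg hx, ← Real.rpow_natCast, ← Real.rpow_mul hx]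
  congr 1
  ring

lemma mqConst_mul_topCoeff (n : ℕ) :
    (-1 : ℝ) ^ n * (2 : ℝ) ^ (-(n : ℝ) / 2) * (mqConst n * topCoeff n) * 2 ^ n = 1 := by
  have exponent : n * (n + 1) / 2 = n + n.choose 2 := by
    rw [Nat.choose_two_right, add_comm n (_ / 2), ← Nat.triangle_succ, Nat.add_sub_cancel, mul_comm]
  have sign : (-1 : ℝ) ^ n * (-1) ^ (n * (n + 1) / 2) * (-1) ^ n.choose 2 = 1 := by
    rw [exponent, ← pow_add, ← pow_add]
    exact Even.neg_one_pow ⟨n + n.choose 2, by ring⟩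
  have scale : (√2)⁻¹ * (√2 * √Real.pi)⁻¹ * √Real.pi * 2 = 1 := by
    have sqrt_pi_ne_zero : √Real.pi ≠ 0 := (Real.sqrt_pos.2 Real.pi_pos).ne'
    field_simp
    exact (Real.sq_sqrt zero_le_two).symm
  calc (-1 : ℝ) ^ n * (2 : ℝ) ^ (-(n : ℝ) / 2) * (mqConst n * topCoeff n) * 2 ^ n
      = ((-1 : ℝ) ^ n * (-1) ^ (n * (n + 1) / 2) * (-1) ^ n.choose 2) *
          ((√2)⁻¹ * (√2 * √Real.pi)⁻¹ * √Real.pi * 2) ^ n := by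
        rw [mqConst, topCoeff, rpow_neg_natCast_div_two zero_le_two,
          rpow_neg_natCast_div_two Real.two_pi_pos.le, Real.sqrt_mul zero_le_two]
        ring
    _ = 1 := by rw [sign, scale, one_pow, mul_one]

lemma exp_form_mul_exp_fiberInner_pr (u : V p q) :
    Real.exp (-Real.pi * form u u) *
      Real.exp (-(2 * Real.pi * fiberInner p (pr p q u) (pr p q u))) = gaussian p q u := by
  rw [← Real.exp_add, gaussian_apply]
  congr 1
  rw [fiberInner_eq_sum, form, siegelMajorant, Fintype.sum_sum_type]
  simp only [pr, LinearMap.coe_mk, AddHom.coe_mk, pow_two]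
  ring

theorem kudlaMillson_eq_smul_pullbackSection (b : Fin q → Z q)
    (hb : ∀ i j, fiberInner p (b i) (b j) = if i = j then 1 else 0) (v : V p q) :
    kudlaMillson v = ((-1 : ℝ) ^ q * Matrix.det (Matrix.of b) *
        ((2 : ℝ) ^ (-(q : ℝ) / 2) * Real.exp (-Real.pi * form v v))) •
      pullbackSection (sectionV v) (mathaiQuillen p q b) := by
  funext g
  rw [Pi.smul_apply, pullbackSection_mathaiQuillen, kudlaMillson, smul_smul, ← form_act g⁻¹ v v]
  set u := act g⁻¹ v
  set c := (-1 : ℝ) ^ q * (Matrix.of b).det * (2 : ℝ) ^ (-(q : ℝ) / 2) * mqConst q with hc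
  have exponentials : (-1 : ℝ) ^ q * (Matrix.of b).det * ((2 : ℝ) ^ (-(q : ℝ) / 2) *
      Real.exp (-Real.pi * form u u)) * (mqConst q *
      Real.exp (-(2 * Real.pi * fiberInner p (pr p q u) (pr p q u)))) = c * gaussian p q u := by
    rw [← exp_form_mul_exp_fiberInner_pr]; ring
  have constants : c * (topCoeff q * (Matrix.of b).det * 2 ^ q) = 1 := by
    calc c * (topCoeff q * (Matrix.of b).det * 2 ^ q)
        = ((-1 : ℝ) ^ q * (2 : ℝ) ^ (-(q : ℝ) / 2) * (mqConst q * topCoeff q) * 2 ^ q) *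
          ((Matrix.of b).det * (Matrix.of b).det) := by rw [hc]; ring
      _ = 1 := by rw [mqConst_mul_topCoeff, det_mul_self_of_orthonormal b hb, one_mul]
  rw [exponentials, ← smul_smul, gaussian_smul_berezinForm_algExp_pullbackExponent, smul_smul,
    constants, one_smul]

end Comparison

end

end KudlaMillson

theorem theorem4p1 (p q : ℕ)
    (b : Fin q → KudlaMillson.Z q)
    (hb : ∀ i j, KudlaMillson.fiberInner p (b i) (b j) = if i = j then 1 else 0)
    (Γ : Subgroup (KudlaMillson.Gplus p q)) (v : KudlaMillson.V p q) :
    KudlaMillson.IsFormOnE (KudlaMillson.stabilizerIn Γ v) q (KudlaMillson.mathaiQuillen p q b) ∧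
    KudlaMillson.IsFormOnD (KudlaMillson.stabilizerIn Γ v) q
      (KudlaMillson.pullbackSection (KudlaMillson.sectionV v)
        (KudlaMillson.mathaiQuillen p q b)) ∧
    KudlaMillson.IsFormOnD (KudlaMillson.stabilizerIn Γ v) q (KudlaMillson.kudlaMillson v) ∧
    KudlaMillson.kudlaMillson v =
      ((-1 : ℝ) ^ q * Matrix.det (Matrix.of b) *
          ((2 : ℝ) ^ (-(q : ℝ) / 2) * Real.exp (-Real.pi * KudlaMillson.form v v))) •
        KudlaMillson.pullbackSection (KudlaMillson.sectionV v)
          (KudlaMillson.mathaiQuillen p q b) := by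
  have pullback := (KudlaMillson.isFormOnE_mathaiQuillen b
    (KudlaMillson.stabilizerIn Γ v)).isFormOnD_pullbackSection fun _ hδ => hδ.2
  have comparison := KudlaMillson.kudlaMillson_eq_smul_pullbackSection b hb v
  exact ⟨KudlaMillson.isFormOnE_mathaiQuillen b _, pullback, comparison ▸ pullback.const_smul _,
    comparison⟩
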